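/- **Systems.** A signature $\Sigma$ consists of finitely many component types $\mathsf C$, finitely many interaction types $\mathsf I$ of arity $\#(\mathsf I)\ge 1$, for each component type a finite set of ports (each port $p$ belongs to exactly one component type $\mathrm{comp}(p)$), and for each $\mathsf I$ a tuple of ports $\langle p_1,\dots,p_{\#(\mathsf I)}\rangle$. A behavior map $\beta$ assigns to each component type a finite state machine over its ports; the state sets are pairwise disjoint, $\mathcal Q$ is the set of all states, and $\mathrm{trans}(\mathsf I)$ is the set of tuples $\langle\tau_1,\dots,\tau_{\#(\mathsf I)}\rangle$ of machine transitions $\tau_i=(s_i\xrightarrow{p_i}s_i')$. Let $\mathbb U$ be a countably infinite set of indices. An architecture $\alpha$ assigns a set $\alpha(\mathsf C)\subseteq\mathbb U$ to each component type and a relation $\alpha(\mathsf I)\subseteq\mathbb U^{\#(\mathsf I)}$ to each interaction type. The Petri net $\mathsf N(\alpha,\beta)$ has the places $q[u]$ ($q$ a state of $\mathsf C$, $u\in\alpha(\mathsf C)$) and a transition $t=(\mathsf I[u_1,\dots,u_k],\langle\tau_1,\dots,\tau_k\rangle)$ for all $\langle u_1,\dots,u_k\rangle\in\alpha(\mathsf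 I)$ and $\langle\tau_i\rangle_i\in\mathrm{trans}(\mathsf I)$ such that $u_i\ne u_j$ or $\mathrm{comp}(p_i)\neq\mathrm{comp}(p_j)$ for all $i\ne j$; here ${}^\bullet t=\{s_i[u_i]\}_i$ and $t^\bullet=\{s'_i[u_i]\}_i$. Markings are sets of places; $t$ is enabled in $\mathrm m$ if ${}^\bullet t\subseteq\mathrm m$ and then leads to $(\mathrm m\setminus{}^\bullet t)\cup t^\bullet$; a deadlock is a marking in which no transition is enabled. A configuration is a pair $(\alpha,\mathrm m)$ with $\mathrm m$ a marking having exactly one place $q[u]$, $q$ a state of $\mathsf C$, for each $\mathsf C$ and $u\in\alpha(\mathsf C)$. **Configuration logic.** Formulas are $\phi::=\mathsf{emp}\mid\mathsf C(x)\mid\mathsf C^q(x)\mid\mathsf I(x_1,\dots,x_{\#(\mathsf I)})\mid\mathsf A(x_1,\dots,x_{\#(\mathsf A)})\mid\phi*\phi\mid\exists x.\phi$, with $\mathsf A$ from a set of predicate symbols with arities. A set of inductive definitions (SID) is a finite set $\Delta=\{\rho_1,\dots,\rho_P\}$ of rules $\mathsf A(x_1,\dots,x_{\#(\mathsf A)})\leftarrow\phi$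 with $\mathrm{fv}(\phi)=\{x_1,\dots,x_{\#(\mathsf A)}\}$. Under a store of indices, $\mathsf{emp}$ describes the empty configuration; $\mathsf C(x)$, resp. $\mathsf C^q(x)$, the single component $\mathsf C[x]$ in some state, resp. in state $q$; $\mathsf I(x_1,\dots)$ the single interaction $\mathsf I[x_1,\dots]$; $*$ is the union of two configurations with disjoint component sets and disjoint interaction relations; and predicate atoms are interpreted inductively (least interpretation) by the rules of $\Delta$. A model of a sentence is a configuration satisfying it. * $\mathit{deadlock}(\phi,\Delta,\beta)$: is there a model $(\alpha,\mathrm m)$ of $\phi$ such that some marking reachable from $\mathrm m$ in $\mathsf N(\alpha,\beta)$ is a deadlock? * $\mathit{reach}(\phi,\langle q_1,\dots,q_n\rangle,\Delta,\beta)$: are there a model $(\alpha,\mathrm m)$ of $\phi$, a marking $\mathrm m'$ reachable from $\mathrm m$ in $\mathsf N(\alpha,\beta)$ and indices $u_1,\dots,u_n$ such that $q_1[u_1],\dots,q_n[u_n]$ are pairwise distinct and belong to $\mathrm m'$? **Assumptions.** (a) $\rho_1=(\mathsf A_\phi()\leftarrow\phi)$, where $\phi$ is the given sentence and $\mathsf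 A_\phi$ is nullary and occurs nowhere else in $\Delta$. (b) Formal parameters of a rule are pairwise distinct and, modulo associativity, commutativity and unit $\mathsf{emp}$ of $*$, each rule is either $\mathsf A(x_1)\leftarrow\mathsf C^q(x_1)$ or $\mathsf A(x_1,\dots,x_{\#(\mathsf A)})\leftarrow\exists y_1\dots\exists y_m.\,\varphi*\psi*\mathsf A_1(\mathbf z^1)*\dots*\mathsf A_p(\mathbf z^p)$ with $p\ge1$, $\varphi$ either $\mathsf{emp}$ or some $\mathsf C^q(x_1)$, $\psi$ a separating conjunction of interaction atoms, $\bigcup_i\mathbf z^i=(\{x_1,\dots,x_{\#(\mathsf A)}\}\setminus\mathrm{fv}(\varphi))\cup\{y_1,\dots,y_m\}$ and $\mathbf z^i\cap\mathbf z^j=\emptyset$ for $i\neq j$. (c) $\kappa\ge1$ and each rule body has at most $\kappa$ predicate atoms, numbered from left to right. (d) $\phi$ is tight: there is a profile $\lambda$, assigning to each predicate symbol $\mathsf A$ of arity $\geq 1$ a tuple of $\#(\mathsf A)$ component types, such that (i) each rule body (in particular $\phi$) contains, for each interaction atom $\mathsf I(x_1,\dots,x_k)$ and each $i$, an atom $\mathsf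 C^q(x_i)$ with $\mathrm{comp}(p_i)=\mathsf C$ or an atom $\mathsf B(y_1,\dots)$ with $x_i=y_\ell$ and $\mathrm{comp}(p_i)=\lambda(\mathsf B)_\ell$ for some $\ell$; and (ii) the body of each rule with head $\mathsf A(x_1,\dots)$ contains, for each $i$, an atom $\mathsf C^q(x_i)$ with $\lambda(\mathsf A)_i=\mathsf C$ or an atom $\mathsf B(y_1,\dots)$ with $x_i=y_\ell$ and $\lambda(\mathsf A)_i=\lambda(\mathsf B)_\ell$ for some $\ell$. **Formulas.** $\mathsf{WS}\kappa\mathsf S$ is monadic second-order logic over the infinite $\kappa$-ary tree $\{1,\dots,\kappa\}^*$ with root $\epsilon$ and successors $x.d$, whose second-order variables range over finite sets of nodes. Use second-order variables $\mathbf R=\langle R_1,\dots,R_P\rangle$ and tuples $\mathbf X=\langle X_q\rangle_{q\in\mathcal Q}$, $\mathbf Y,\mathbf Z,\mathbf Y',\mathbf Z'$ of the same shape; $\mathbf X\cap\mathbf Y$ denotes $\bigcup_q X_q\cap Y_q$, and $\mathbf Y\subseteq\mathbf X$ means $Y_q\subseteq X_q$ for all $q$. * $\mathit{RewrTree}_\Delta(\mathbf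 R)$: the $R_i$ are pairwise disjoint, $R_1=\{\epsilon\}$, $\bigcup_i R_i$ is prefix-closed, and, for each $x\in R_i$ and $1\le d\le\kappa$: if the body of $\rho_i$ has a $d$-th predicate atom, with symbol $\mathsf A'$, then $x.d\in R_\ell$ for some rule $\rho_\ell$ with head symbol $\mathsf A'$; otherwise $x.d\notin\bigcup_\ell R_\ell$. * $\mathit{Mark}(\mathbf X,\mathbf R)$: for each component type $\mathsf C$, the sets $X_q$ ($q$ a state of $\mathsf C$) are pairwise disjoint and their union is the union of the $R_j$ such that an atom $\mathsf C^{q}(z)$ occurs in $\rho_j$ for some $q,z$. * $\mathit{Path}^v_{\rho}(x,y,\mathbf R)$, for a variable $v$ of the body of $\rho$: uses the path automaton with states $s^z_{\rho'}$ ($z$ a variable of the body of $\rho'\in\Delta$), initial state $s^v_\rho$, final states all $s^z_{\rho'}$ such that some atom $\mathsf C^q(z)$ occurs in $\rho'$, and transitions $s^{y_j}_{\rho'}\xrightarrow{d}s^{x_j}_{\rho''}$ whenever the $d$-th predicate atom of $\rho'$ is $\mathsf A'(y_1,\dots)$ and $\rho''$ has head $\mathsf A'(x_1,\dots)$. The formula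 states that there are finite sets $Y_s$, one for each state $s$, that are pairwise disjoint and satisfy: $Y_{s^z_{\rho_i}}\subseteq R_i$; $x$ is in $Y_s$ for an initial $s$; $y$ is in $Y_s$ for a final $s$; for all $s$ and $z\in Y_s$ with $z\neq y$ there is a transition $s\xrightarrow{d}s'$ with $z.d\in Y_{s'}$; and for all $s'$ and $z\in Y_{s'}$ with $z\ne x$ there are a transition $s\xrightarrow{d}s'$ and $z'\in Y_s$ with $z'.d=z$. * $\Phi(\mathbf X,\mathbf X',\mathbf R)$: the disjunction, over all $\ell$ and all interaction atoms $\mathsf I(x_1,\dots,x_k)$ of $\rho_\ell$, of: there are nodes $y_0,\dots,y_k$ with $R_\ell(y_0)$, $\bigwedge_{i}\mathit{Path}^{x_i}_{\rho_\ell}(y_0,y_i,\mathbf R)$, for some $\langle\tau_i=(s_i\xrightarrow{p_i}s'_i)\rangle_i\in\mathrm{trans}(\mathsf I)$ and all $q\in\mathcal Q$, $X_q=\{y_i\mid s_i=q\}$ and $X'_q=\{y_i\mid s'_i=q\}$, and, for all $i<j$, $y_i\neq y_j$ or $\mathrm{comp}(p_i)\neq\mathrm{comp}(p_j)$. * $\mathit{Init}(\mathbf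 Y,\mathbf R)$: $\mathit{Mark}(\mathbf Y,\mathbf R)$ and, for each state $q$, $Y_q$ is the union of the $R_\ell$ such that an atom $\mathsf C^q(z)$ occurs in $\rho_\ell$. * $\theta(\mathbf X,\mathbf R)$: $\forall\mathbf Y'\forall\mathbf Z'.\ \Phi(\mathbf Y',\mathbf Z',\mathbf R)\to(\mathbf X\cap\mathbf Y'\neq\emptyset\to\mathbf X\cap\mathbf Z'\ne\emptyset)$. * $\Theta(\mathbf X,\mathbf Y,\mathbf R)$: $\mathit{Mark}(\mathbf X,\mathbf R)\wedge\forall\mathbf Z.\ (\mathbf Y\cap\mathbf Z\ne\emptyset\wedge\theta(\mathbf Z,\mathbf R))\to\mathbf X\cap\mathbf Z\neq\emptyset$. * $\omega(\mathbf X,\mathbf R)$: $\forall\mathbf Y'\forall\mathbf Z'.\ \Phi(\mathbf Y',\mathbf Z',\mathbf R)\to\big((\mathbf X\cap\mathbf Y'=\emptyset\leftrightarrow\mathbf X\cap\mathbf Z'=\emptyset)\wedge(|\mathbf X\cap\mathbf Y'|=1\leftrightarrow|\mathbf X\cap\mathbf Z'|=1)\big)$. * $\Omega(\mathbf X,\mathbf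 Y,\mathbf R)$: $\mathit{Mark}(\mathbf X,\mathbf R)\wedge\forall\mathbf Z.\ (|\mathbf Y\cap\mathbf Z|=1\wedge\omega(\mathbf Z,\mathbf R))\to|\mathbf X\cap\mathbf Z|=1$. * $\mathit{DeadLock}(\mathbf X,\mathbf R)$: $\forall\mathbf Y'\forall\mathbf Z'.\ \Phi(\mathbf Y',\mathbf Z',\mathbf R)\to\neg(\mathbf Y'\subseteq\mathbf X)$. * $\mathit{ErrSet}_{\langle q_1,\dots,q_n\rangle}(\mathbf X)$: $\bigwedge_{q\in\mathcal Q}|X_q|\ge|\{i\mid q_i=q\}|$. **Theorem.** Let $\phi$ be a tight sentence interpreted over a SID $\Delta$, let $\beta$ be a behavior map and $\langle q_1,\dots,q_n\rangle$ a tuple of states, under the assumptions above. 1. If $\mathit{DeadLock}(\mathbf X,\mathbf R)\wedge\Theta(\mathbf X,\mathbf Y,\mathbf R)\wedge\Omega(\mathbf X,\mathbf Y,\mathbf R)\wedge\mathit{Init}(\mathbf Y,\mathbf R)\wedge\mathit{RewrTree}_\Delta(\mathbf R)$ is unsatisfiable, then $\mathit{deadlock}(\phi,\Delta,\beta)$ has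 a negative answer. 2. If $\mathit{ErrSet}_{\langle q_1,\dots,q_n\rangle}(\mathbf X)\wedge\Theta(\mathbf X,\mathbf Y,\mathbf R)\wedge\Omega(\mathbf X,\mathbf Y,\mathbf R)\wedge\mathit{Init}(\mathbf Y,\mathbf R)\wedge\mathit{RewrTree}_\Delta(\mathbf R)$ is unsatisfiable, then $\mathit{reach}(\phi,\langle q_1,\dots,q_n\rangle,\Delta,\beta)$ has a negative answer. -/

import Mathlib

/-! # Component-based systems, the configuration logic, and WSκS verification conditions -/

namespace CBS

noncomputable section

open scoped Classical

/-! ## Signatures, behaviors, architectures -/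

/-- A signature: finitely many component types, finitely many interaction types of arity at
least one, and an interface. Each port belongs to the interface of exactly one component type,
given by `compOf`; the interface of an interaction type is a tuple of ports. -/
structure Signature where
  Comp : Type
  Inter : Type
  Port : Type
  [fintypeComp : Fintype Comp]
  [fintypeInter : Fintype Inter]
  [finitePort : Finite Port]
  compOf : Port → Comp
  arity : Inter → ℕ
  arity_pos : ∀ I, 1 ≤ arity I
  iports : (I : Inter) → Fin (arity I) → Port

attribute [instance] Signature.fintypeComp Signature.fintypeInter Signature.finitePort

/-- The interface (set of ports) of a component type. -/
def Signature.ports (S : Signature) (C : S.Comp) : Set S.Port := {p | S.compOf p = C}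

/-- A behavior map: a finite state machine for each component type. The state sets of distinct
component types are disjoint, so there is one finite type `State` of all states, and `comp q` is
the component type that the state `q` belongs to. `step q p q'` is the transition relation;
a machine only uses the ports and the states of its own component type. -/
structure Behavior (S : Signature) where
  State : Type
  [fintypeState : Fintype State]
  comp : State → S.Comp
  step : State → S.Port → State → Prop
  step_comp : ∀ {q p q'}, step q p q' → comp q = S.compOf p ∧ comp q' = S.compOf p

attribute [instance] Behavior.fintypeState

/-- An architecture over `S` with indices from `U`. -/
structure Architecture (S : Signature) (U : Type*) where
  comp : S.Comp → Set U
  inter : (I : S.Inter) → Set (Fin (S.arity I) → U)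

/-! ## Petri nets and the operational semantics

All markings are boolean, i.e. sets of places. -/

/-- A Petri net, with edges from places to transitions and from transitions to places. -/
structure PetriNet (Pl Tr : Type*) where
  places : Set Pl
  transitions : Set Tr
  edgeIn : Pl → Tr → Prop
  edgeOut : Tr → Pl → Prop

namespace PetriNet

variable {Pl Tr : Type*} (N : PetriNet Pl Tr)

def pre (t : Tr) : Set Pl := {s | N.edgeIn s t}

def post (t : Tr) : Set Pl := {s | N.edgeOut t s}

def Enabled (t : Tr) (m : Set Pl) : Prop := N.pre t ⊆ m

/-- The firing of a transition, for boolean markings. -/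
def Fires (t : Tr) (m m' : Set Pl) : Prop :=
  N.Enabled t m ∧ m' = (m \ N.pre t) ∪ N.post t

/-- The markings reachable from `m` by a finite firing sequence. -/
def reach (m : Set Pl) : Set (Set Pl) :=
  {m' | Relation.ReflTransGen (fun a b => ∃ t ∈ N.transitions, N.Fires t a b) m m'}

/-- The deadlock markings. -/
def dead : Set (Set Pl) := {m | ∀ t ∈ N.transitions, ¬ N.Enabled t m}

end PetriNet

/-- A place `q[u]` is the pair `(q, u)`. -/
abbrev Place {S : Signature} (β : Behavior S) (U : Type*) := β.State × U

/-- Carrier for the net transitions `(I[u₁,…,u_k], ⟨t₁,…,t_k⟩)`. The port of `tᵢ` is the `i`-th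
port of `I`, so `tᵢ` is given by its source and its target state. -/
structure NetTransition {S : Signature} (β : Behavior S) (U : Type*) where
  inter : S.Inter
  idx : Fin (S.arity inter) → U
  src : Fin (S.arity inter) → β.State
  dst : Fin (S.arity inter) → β.State

/-- The tuples of transitions `⟨t₁,…,t_k⟩`, `tᵢ = (src i → dst i)`, that synchronize by `I`. -/
def Behavior.Sync {S : Signature} (β : Behavior S) (I : S.Inter)
    (src dst : Fin (S.arity I) → β.State) : Prop :=
  ∀ i, β.step (src i) (S.iports I i) (dst i)

/-- The Petri net of the system `(S, α, β)`. -/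
def systemNet {S : Signature} {U : Type*} (α : Architecture S U) (β : Behavior S) :
    PetriNet (Place β U) (NetTransition β U) where
  places := {s | s.2 ∈ α.comp (β.comp s.1)}
  transitions := {t | t.idx ∈ α.inter t.inter ∧ β.Sync t.inter t.src t.dst ∧
    ∀ i j, i ≠ j → t.idx i ≠ t.idx j ∨
      S.compOf (S.iports t.inter i) ≠ S.compOf (S.iports t.inter j)}
  edgeIn := fun s t => ∃ i, s = (t.src i, t.idx i)
  edgeOut := fun t s => ∃ i, s = (t.dst i, t.idx i)

/-! ## The configuration logic -/

/-- Predicate symbols: countably many for each arity. -/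
structure PredSym where
  name : ℕ
  arity : ℕ

/-- Formulas of the configuration logic; the first-order variables are natural numbers.
`compAt q x` is the component atom `C^q(x)`, where `C` is the component type of `q`. -/
inductive CL {S : Signature} (β : Behavior S) where
  | emp : CL β
  | comp (C : S.Comp) (x : ℕ) : CL β
  | compAt (q : β.State) (x : ℕ) : CL β
  | inter (I : S.Inter) (x : Fin (S.arity I) → ℕ) : CL β
  | pred (A : PredSym) (x : Fin A.arity → ℕ) : CL β
  | star (φ ψ : CL β) : CL β
  | ex (x : ℕ) (φ : CL β) : CL β

namespace CL

variable {S : Signature} {β : Behavior S}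

/-- Free variables. -/
def fv : CL β → Finset ℕ
  | emp => ∅
  | comp _ x => {x}
  | compAt _ x => {x}
  | inter _ x => Finset.univ.image x
  | pred _ x => Finset.univ.image x
  | star φ ψ => φ.fv ∪ ψ.fv
  | ex x φ => φ.fv.erase x

/-- All variables that occur in atoms: for `∃ y₁ … ∃ yₙ. ψ` with `ψ` quantifier-free, these are
the free variables of `ψ`. -/
def vars : CL β → Finset ℕ
  | emp => ∅
  | comp _ x => {x}
  | compAt _ x => {x}
  | inter _ x => Finset.univ.image x
  | pred _ x => Finset.univ.image x
  | star φ ψ => φ.vars ∪ ψ.vars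
  | ex _ φ => φ.vars

def IsSentence (φ : CL β) : Prop := φ.fv = ∅

def QFree : CL β → Prop
  | star φ ψ => φ.QFree ∧ ψ.QFree
  | ex _ _ => False
  | _ => True

/-- The occurrences of atoms `C(x)`, from left to right. -/
def plainAtoms : CL β → List (S.Comp × ℕ)
  | comp C x => [(C, x)]
  | star φ ψ => φ.plainAtoms ++ ψ.plainAtoms
  | ex _ φ => φ.plainAtoms
  | _ => []

/-- The occurrences of atoms `C^q(x)`, from left to right. -/
def stateAtoms : CL β → List (β.State × ℕ)
  | compAt q x => [(q, x)]
  | star φ ψ => φ.stateAtoms ++ ψ.stateAtoms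
  | ex _ φ => φ.stateAtoms
  | _ => []

/-- The occurrences of interaction atoms, from left to right. -/
def interAtoms : CL β → List (Σ I : S.Inter, Fin (S.arity I) → ℕ)
  | inter I x => [⟨I, x⟩]
  | star φ ψ => φ.interAtoms ++ ψ.interAtoms
  | ex _ φ => φ.interAtoms
  | _ => []

/-- The occurrences of predicate atoms, from left to right. -/
def predAtoms : CL β → List (Σ A : PredSym, Fin A.arity → ℕ)
  | pred A x => [⟨A, x⟩]
  | star φ ψ => φ.predAtoms ++ ψ.predAtoms
  | ex _ φ => φ.predAtoms
  | _ => []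

/-- The number of occurrences of predicate atoms. -/
def npred (φ : CL β) : ℕ := φ.predAtoms.length

/-- `∃ y₁ … ∃ yₙ. φ`. -/
def exs (ys : List ℕ) (φ : CL β) : CL β := ys.foldr ex φ

end CL

/-- A rule `A(x₁,…,x_k) ← φ`, where the free variables of `φ` are `x₁,…,x_k`. -/
structure Rule {S : Signature} (β : Behavior S) where
  head : PredSym
  params : Fin head.arity → ℕ
  body : CL β
  fv_body : body.fv = Finset.univ.image params

/-- A (finite) set of inductive definitions, enumerated without repetition. -/
structure SID {S : Signature} (β : Behavior S) where
  size : ℕ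
  rule : Fin size → Rule β
  rule_injective : Function.Injective rule

/-- An architecture together with a marking. (That the marking is precise, i.e. has exactly one
state for each component and no other places, holds for all models of formulas and for all
markings reachable from these.) -/
structure Config {S : Signature} (β : Behavior S) (U : Type*) where
  arch : Architecture S U
  mark : Set (Place β U)

/-- `c` is the (defined) composition of `c₁` and `c₂`. -/
def Config.IsComposition {S : Signature} {β : Behavior S} {U : Type*}
    (c c₁ c₂ : Config β U) : Prop :=
  (∀ C, Disjoint (c₁.arch.comp C) (c₂.arch.comp C)) ∧
  (∀ I, Disjoint (c₁.arch.inter I) (c₂.arch.inter I)) ∧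
  (∀ C, c.arch.comp C = c₁.arch.comp C ∪ c₂.arch.comp C) ∧
  (∀ I, c.arch.inter I = c₁.arch.inter I ∪ c₂.arch.inter I) ∧
  c.mark = c₁.mark ∪ c₂.mark

/-- The satisfaction relation of the configuration logic. In the clause for predicate atoms the
substitution of the formal by the actual parameters is performed on the store. -/
inductive Sat {S : Signature} {β : Behavior S} {U : Type*} (Δ : SID β) :
    Config β U → (ℕ → U) → CL β → Prop
  | emp (c : Config β U) (s : ℕ → U)
      (hC : ∀ C, c.arch.comp C = ∅) (hI : ∀ I, c.arch.inter I = ∅) (hm : c.mark = ∅) :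
      Sat Δ c s CL.emp
  | comp (c : Config β U) (s : ℕ → U) (C : S.Comp) (x : ℕ) (q : β.State) (hq : β.comp q = C)
      (hC : c.arch.comp C = {s x}) (hC' : ∀ C', C' ≠ C → c.arch.comp C' = ∅)
      (hI : ∀ I, c.arch.inter I = ∅) (hm : c.mark = {(q, s x)}) :
      Sat Δ c s (CL.comp C x)
  | compAt (c : Config β U) (s : ℕ → U) (q : β.State) (x : ℕ)
      (hC : c.arch.comp (β.comp q) = {s x})
      (hC' : ∀ C', C' ≠ β.comp q → c.arch.comp C' = ∅)
      (hI : ∀ I, c.arch.inter I = ∅) (hm : c.mark = {(q, s x)}) :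
      Sat Δ c s (CL.compAt q x)
  | inter (c : Config β U) (s : ℕ → U) (I : S.Inter) (x : Fin (S.arity I) → ℕ)
      (hC : ∀ C, c.arch.comp C = ∅)
      (hI : c.arch.inter I = {fun k => s (x k)})
      (hI' : ∀ I', I' ≠ I → c.arch.inter I' = ∅) (hm : c.mark = ∅) :
      Sat Δ c s (CL.inter I x)
  | pred (c : Config β U) (s s' : ℕ → U) (A : PredSym) (x : Fin A.arity → ℕ)
      (i : Fin Δ.size) (hA : A = (Δ.rule i).head)
      (hs : ∀ j : Fin A.arity,
        s' ((Δ.rule i).params (Fin.cast (congrArg PredSym.arity hA) j)) = s (x j))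
      (h : Sat Δ c s' (Δ.rule i).body) :
      Sat Δ c s (CL.pred A x)
  | star (c c₁ c₂ : Config β U) (s : ℕ → U) (φ ψ : CL β) (hc : c.IsComposition c₁ c₂)
      (h₁ : Sat Δ c₁ s φ) (h₂ : Sat Δ c₂ s ψ) :
      Sat Δ c s (CL.star φ ψ)
  | ex (c : Config β U) (s : ℕ → U) (x : ℕ) (u : U) (φ : CL β)
      (h : Sat Δ c (Function.update s x u) φ) :
      Sat Δ c s (CL.ex x φ)

/-- `c` is a model of the sentence `φ`. -/
def Models {S : Signature} {β : Behavior S} {U : Type*} (Δ : SID β) (c : Config β U)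
    (φ : CL β) : Prop :=
  ∃ s : ℕ → U, Sat Δ c s φ

/-! ## The decision problems -/

/-- The query `deadlock(φ, Δ, β)` has a positive answer (indices are taken from `U`). -/
def Deadlock {S : Signature} {β : Behavior S} (U : Type*) (φ : CL β) (Δ : SID β) : Prop :=
  ∃ c : Config β U, Models Δ c φ ∧
    ((systemNet c.arch β).reach c.mark ∩ (systemNet c.arch β).dead).Nonempty

/-- The query `reach(φ, ⟨q₁,…,qₙ⟩, Δ, β)` has a positive answer (indices are taken from `U`). -/
def Reach {S : Signature} {β : Behavior S} (U : Type*) (φ : CL β) {n : ℕ}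
    (q : Fin n → β.State) (Δ : SID β) : Prop :=
  ∃ (c : Config β U) (m' : Set (Place β U)) (u : Fin n → U), Models Δ c φ ∧
    m' ∈ (systemNet c.arch β).reach c.mark ∧
    (∀ i, (q i, u i) ∈ m') ∧
    ∀ i j, i ≠ j → (q i, u i) ≠ (q j, u j)

/-! ## Standing assumptions on the inductive definitions, and tightness -/

section Assumptions

variable {S : Signature} {β : Behavior S}

/-- The rule with index `r` is `A_φ() ← φ`, where the nullary symbol `A_φ` occurs nowhere else in
the rules. -/
def SID.IsSentenceRule (Δ : SID β) (r : Fin Δ.size) (φ : CL β) : Prop :=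
  (Δ.rule r).head.arity = 0 ∧ (Δ.rule r).body = φ ∧
  (∀ i, i ≠ r → (Δ.rule i).head ≠ (Δ.rule r).head) ∧
  ∀ i, ∀ a ∈ (Δ.rule i).body.predAtoms, a.1 ≠ (Δ.rule r).head

/-- A rule `A(x₁) ← C^q(x₁)`. -/
def Rule.IsBase (ρ : Rule β) : Prop :=
  ρ.head.arity = 1 ∧ ρ.body.QFree ∧ ρ.body.plainAtoms = [] ∧ ρ.body.interAtoms = [] ∧
  ρ.body.predAtoms = [] ∧ ∃ (q : β.State) (k : Fin ρ.head.arity),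
    ρ.body.stateAtoms = [(q, ρ.params k)]

/-- A rule `A(x₁,…,x_k) ← ∃ y₁ … ∃ yₙ. φ * ψ * A₁(z¹) * … * A_p(z^p)` with `p ≥ 1`, where `φ` is
`emp` or `C^q(x₁)`, `ψ` is a separating conjunction of interaction atoms, the variables in
`z¹, …, z^p` are those `xᵢ` that do not occur in `φ` and the `yᵢ`, and distinct tuples
`zⁱ`, `z^j` have no variable in common. Formulas are read modulo associativity, commutativity
and unit `emp` of `*`. -/
def Rule.IsInductive (ρ : Rule β) : Prop :=
  ∃ (ys : List ℕ) (M : CL β), ρ.body = CL.exs ys M ∧ M.QFree ∧ M.plainAtoms = [] ∧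
    1 ≤ M.npred ∧
    (M.stateAtoms = [] ∨
      ∃ (q : β.State) (h : 0 < ρ.head.arity), M.stateAtoms = [(q, ρ.params ⟨0, h⟩)]) ∧
    {v : ℕ | ∃ a ∈ M.predAtoms, ∃ j, a.2 j = v} =
      (Set.range ρ.params \ {v | ∃ q, (q, v) ∈ M.stateAtoms}) ∪ {v | v ∈ ys} ∧
    M.predAtoms.Pairwise fun a b => Disjoint (Set.range a.2) (Set.range b.2)

/-- Each rule has pairwise distinct formal parameters and one of the two forms above. -/
def SID.IsStandard (Δ : SID β) : Prop :=
  ∀ i, Function.Injective (Δ.rule i).params ∧ ((Δ.rule i).IsBase ∨ (Δ.rule i).IsInductive)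

/-- A profile assigns to each predicate symbol a tuple of component types. -/
abbrev Profile (S : Signature) := (A : PredSym) → Fin A.arity → S.Comp

/-- The formula `φ` is tight for the profile `lam`. -/
def CL.TightFor (φ : CL β) (lam : Profile S) : Prop :=
  ∀ a ∈ φ.interAtoms, ∀ k : Fin (S.arity a.1),
    (∃ q, (q, a.2 k) ∈ φ.stateAtoms ∧ S.iports a.1 k ∈ S.ports (β.comp q)) ∨
    ∃ b ∈ φ.predAtoms, ∃ l, a.2 k = b.2 l ∧ S.iports a.1 k ∈ S.ports (lam b.1 l)

/-- The SID `Δ` is tight, with profile `lam`. -/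
def SID.TightFor (Δ : SID β) (lam : Profile S) : Prop :=
  ∀ i, (Δ.rule i).body.TightFor lam ∧ ∀ k : Fin (Δ.rule i).head.arity,
    (∃ q, (q, (Δ.rule i).params k) ∈ (Δ.rule i).body.stateAtoms ∧
      lam (Δ.rule i).head k = β.comp q) ∨
    ∃ b ∈ (Δ.rule i).body.predAtoms, ∃ l, (Δ.rule i).params k = b.2 l ∧
      lam (Δ.rule i).head k = lam b.1 l

/-- `φ`, interpreted over the tight SID `Δ`, is tight. -/
def CL.IsTight (φ : CL β) (Δ : SID β) : Prop :=
  ∃ lam : Profile S, Δ.TightFor lam ∧ φ.TightFor lam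

end Assumptions

/-! ## The weak second-order calculus of `κ` successors -/

/-- Nodes of the infinite `κ`-ary tree. -/
abbrev Node (κ : ℕ) := List (Fin κ)

inductive WTerm (κ : ℕ) (V : Type) where
  | eps : WTerm κ V
  | var (x : V) : WTerm κ V
  | succ (t : WTerm κ V) (i : Fin κ) : WTerm κ V

/-- Formulas with first-order variables from `V` and second-order variables from `W`. -/
inductive WForm (κ : ℕ) (V W : Type) where
  | eq (t₁ t₂ : WTerm κ V) : WForm κ V W
  | mem (X : W) (t : WTerm κ V) : WForm κ V W
  | and (ξ₁ ξ₂ : WForm κ V W) : WForm κ V W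
  | neg (ξ : WForm κ V W) : WForm κ V W
  | ex1 (x : V) (ξ : WForm κ V W) : WForm κ V W
  | ex2 (X : W) (ξ : WForm κ V W) : WForm κ V W

/-- Second-order variables are interpreted by finite sets of nodes. -/
structure WStore (κ : ℕ) (V W : Type) where
  fo : V → Node κ
  so : W → Finset (Node κ)

def WTerm.eval {κ : ℕ} {V : Type} (f : V → Node κ) : WTerm κ V → Node κ
  | eps => []
  | var x => f x
  | succ t i => t.eval f ++ [i]

namespace WForm

variable {κ : ℕ} {V W : Type}

def Holds : WForm κ V W → WStore κ V W → Prop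
  | eq t₁ t₂, ν => t₁.eval ν.fo = t₂.eval ν.fo
  | mem X t, ν => t.eval ν.fo ∈ ν.so X
  | and ξ₁ ξ₂, ν => ξ₁.Holds ν ∧ ξ₂.Holds ν
  | neg ξ, ν => ¬ ξ.Holds ν
  | ex1 x ξ, ν => ∃ w : Node κ, ξ.Holds { ν with fo := Function.update ν.fo x w }
  | ex2 X ξ, ν => ∃ A : Finset (Node κ), ξ.Holds { ν with so := Function.update ν.so X A }

def Satisfiable (ξ : WForm κ V W) : Prop := ∃ ν, ξ.Holds ν

/-! Derived connectives -/

def tt : WForm κ V W := eq .eps .eps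

def ff : WForm κ V W := neg tt

def or (ξ₁ ξ₂ : WForm κ V W) : WForm κ V W := neg (and (neg ξ₁) (neg ξ₂))

def imp (ξ₁ ξ₂ : WForm κ V W) : WForm κ V W := or (neg ξ₁) ξ₂

def iff (ξ₁ ξ₂ : WForm κ V W) : WForm κ V W := and (imp ξ₁ ξ₂) (imp ξ₂ ξ₁)

def all1 (x : V) (ξ : WForm κ V W) : WForm κ V W := neg (ex1 x (neg ξ))

def all2 (X : W) (ξ : WForm κ V W) : WForm κ V W := neg (ex2 X (neg ξ))

def ne (t₁ t₂ : WTerm κ V) : WForm κ V W := neg (eq t₁ t₂)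

/-- The constant formula for a condition that does not depend on the store. -/
def const (p : Prop) : WForm κ V W := if p then tt else ff

/-- Finite conjunction. -/
def bigAnd {ι : Type*} (s : Finset ι) (f : ι → WForm κ V W) : WForm κ V W :=
  (s.toList.map f).foldr and tt

/-- Finite disjunction. -/
def bigOr {ι : Type*} (s : Finset ι) (f : ι → WForm κ V W) : WForm κ V W :=
  (s.toList.map f).foldr or ff

def exs1 (xs : List V) (ξ : WForm κ V W) : WForm κ V W := xs.foldr ex1 ξ

def exs2 (Xs : List W) (ξ : WForm κ V W) : WForm κ V W := Xs.foldr ex2 ξ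

def alls2 (Xs : List W) (ξ : WForm κ V W) : WForm κ V W := Xs.foldr all2 ξ

end WForm

/-! ## The variables of the verification conditions -/

/-- First-order variables. -/
inductive FOVar where
  | x : FOVar
  | z : FOVar
  | zz : FOVar
  | y (i : ℕ) : FOVar

/-- Names of the copies of the tuple `⟨X_q | q a state⟩` of second-order variables. -/
inductive Copy where
  | X : Copy
  | Y : Copy
  | Z : Copy
  | YY : Copy
  | ZZ : Copy

/-- Second-order variables: `R_i` for each rule, several copies of the tuple
`⟨X_q | q a state⟩`, and `Y^v_{ρ_i}` for the state `s^v_{ρ_i}` of a path automaton. -/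
inductive SOVar (P : ℕ) (Q : Type) where
  | R (i : Fin P) : SOVar P Q
  | mk (c : Copy) (q : Q) : SOVar P Q
  | run (i : Fin P) (v : ℕ) : SOVar P Q

/-! ## Path automata -/

/-- A path automaton. -/
structure PathAut (κ : ℕ) (σ : Type) where
  states : Finset σ
  init : Finset σ
  final : Finset σ
  trans : Finset (σ × Fin κ × σ)

open WForm in
/-- The formula of a path automaton: it holds for nodes `x`, `y` and a labeling `Y` of nodes by
states that describes an accepting run over the path from `x` down to `y`.
Here `x` and `y` are distinct from the bound variables `z` and `zz`. -/
def PathAut.form {κ : ℕ} {σ W : Type} (A : PathAut κ σ) (Y : σ → W) (x y : FOVar) :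
    WForm κ FOVar W :=
  and (bigAnd ((A.states ×ˢ A.states).filter fun p => p.1 ≠ p.2) fun p =>
      all1 .z (or (neg (mem (Y p.1) (.var .z))) (neg (mem (Y p.2) (.var .z))))) <|
  and (bigOr A.init fun s => mem (Y s) (.var x)) <|
  and (bigOr A.final fun s => mem (Y s) (.var y)) <|
  and (bigAnd A.states fun s =>
      all1 .z (imp (and (ne (.var .z) (.var y)) (mem (Y s) (.var .z)))
        (bigOr (A.trans.filter fun t => t.1 = s) fun t =>
          mem (Y t.2.2) (.succ (.var .z) t.2.1)))) <|
  (bigAnd A.states fun s =>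
      all1 .z (imp (and (ne (.var .z) (.var x)) (mem (Y s) (.var .z)))
        (bigOr (A.trans.filter fun t => t.2.2 = s) fun t =>
          ex1 .zz (and (eq (.succ (.var .zz) t.2.1) (.var .z)) (mem (Y t.1) (.var .zz))))))

/-! ## The verification conditions -/

section VC

open WForm

variable {S : Signature} {β : Behavior S} (κ : ℕ) (Δ : SID β)

/-- The formulas in the variables above. -/
abbrev Form : Type := WForm κ FOVar (SOVar Δ.size β.State)

/-- `R_i(t)`. -/
def inR (i : Fin Δ.size) (t : WTerm κ FOVar) : Form κ Δ := mem (.R i) t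

/-- `X_q(t)`, for the copy `c` of the tuple. -/
def inM (c : Copy) (q : β.State) (t : WTerm κ FOVar) : Form κ Δ := mem (.mk c q) t

/-- The quantifier `∀ X⃗` over the copy `c` of the tuple. -/
def allM (c : Copy) (ξ : Form κ Δ) : Form κ Δ :=
  alls2 ((Finset.univ : Finset β.State).toList.map (SOVar.mk c)) ξ

/-- `RewrTree`: the `R_i` describe a rewriting tree with root labeled by the rule `r`. -/
def rewrTree (r : Fin Δ.size) : Form κ Δ :=
  and (all1 .x (and
    (bigAnd ((Finset.univ : Finset (Fin Δ.size × Fin Δ.size)).filter fun p => p.1 < p.2) fun p =>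
      or (neg (inR κ Δ p.1 (.var .x))) (neg (inR κ Δ p.2 (.var .x))))
    (iff (inR κ Δ r (.var .x)) (eq (.var .x) .eps)))) <|
  and (all1 .x (bigAnd Finset.univ fun i => bigAnd Finset.univ fun d : Fin κ =>
    imp (inR κ Δ i (.succ (.var .x) d)) (bigOr Finset.univ fun j => inR κ Δ j (.var .x)))) <|
  and (all1 .x (bigAnd Finset.univ fun i =>
    bigAnd (Finset.univ.filter fun d : Fin κ => d.val < (Δ.rule i).body.npred) fun d =>
      imp (inR κ Δ i (.var .x))
        (bigOr (Finset.univ.filter fun l =>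
            ((Δ.rule i).body.predAtoms.map Sigma.fst)[d.val]? = some (Δ.rule l).head) fun l =>
          inR κ Δ l (.succ (.var .x) d)))) <|
  all1 .x (bigAnd Finset.univ fun i =>
    bigAnd (Finset.univ.filter fun d : Fin κ => (Δ.rule i).body.npred ≤ d.val) fun d =>
      imp (inR κ Δ i (.var .x))
        (bigAnd Finset.univ fun l => neg (inR κ Δ l (.succ (.var .x) d))))

/-- The formula defining the precise markings. -/
def markForm (c : Copy) : Form κ Δ :=
  all1 .x (bigAnd Finset.univ fun C : S.Comp => and
    (bigAnd ((Finset.univ : Finset (β.State × β.State)).filter fun p =>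
        p.1 ≠ p.2 ∧ β.comp p.1 = C ∧ β.comp p.2 = C) fun p =>
      or (neg (inM κ Δ c p.1 (.var .x))) (neg (inM κ Δ c p.2 (.var .x))))
    (iff
      (bigOr (Finset.univ.filter fun q => β.comp q = C) fun q => inM κ Δ c q (.var .x))
      (bigOr (Finset.univ.filter fun j =>
          ∃ a ∈ (Δ.rule j).body.stateAtoms, β.comp a.1 = C) fun j => inR κ Δ j (.var .x))))

/-- The states `s^v_ρ` of the path automata are the pairs of (the index of) a rule `ρ` and a
variable `v` that occurs in its body. -/
def autStates : Finset (Fin Δ.size × ℕ) :=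
  Finset.univ.biUnion fun i => (Δ.rule i).body.vars.image fun v => (i, v)

/-- The path automaton that tracks the variable `v` from (a node labeled by) the rule `i`. -/
def pathAut (i : Fin Δ.size) (v : ℕ) : PathAut κ (Fin Δ.size × ℕ) where
  states := autStates Δ
  init := {(i, v)}
  final := (autStates Δ).filter fun s => ∃ q, (q, s.2) ∈ (Δ.rule s.1).body.stateAtoms
  trans := (autStates Δ ×ˢ (Finset.univ : Finset (Fin κ)) ×ˢ autStates Δ).filter fun t =>
    ∃ (y : Fin (Δ.rule t.2.2.1).head.arity → ℕ) (j : Fin (Δ.rule t.2.2.1).head.arity),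
      (Δ.rule t.1.1).body.predAtoms[t.2.1.val]? = some ⟨(Δ.rule t.2.2.1).head, y⟩ ∧
      y j = t.1.2 ∧ (Δ.rule t.2.2.1).params j = t.2.2.2

/-- The second-order variable of a state of a path automaton. -/
def runVar (s : Fin Δ.size × ℕ) : SOVar Δ.size β.State := .run s.1 s.2

/-- The formula `Υ`: a node visited in a state of the rule `ρ_i` is labeled by `ρ_i`. -/
def upsilon : Form κ Δ :=
  bigAnd (autStates Δ) fun s =>
    all1 .x (imp (mem (runVar Δ s) (.var .x)) (inR κ Δ s.1 (.var .x)))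

/-- The formula `Path^v_{ρ_i}(x, y, R⃗)`. -/
def pathForm (i : Fin Δ.size) (v : ℕ) (x y : FOVar) : Form κ Δ :=
  exs2 ((autStates Δ).toList.map (runVar Δ))
    (and ((pathAut κ Δ i v).form (runVar Δ) x y) (upsilon κ Δ))

/-- `X_q = {y_i | i ∈ s}`, for the copy `c`. -/
def setEq (c : Copy) (q : β.State) {k : ℕ} (s : Finset (Fin k)) : Form κ Δ :=
  all1 .x (iff (inM κ Δ c q (.var .x)) (bigOr s fun i => eq (.var .x) (.var (.y (i + 1)))))

/-- The formula `Ψ` for the interaction atom `I(v₁,…,v_k)` of the rule `l`. -/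
def flowAtom (l : Fin Δ.size) (I : S.Inter) (v : Fin (S.arity I) → ℕ) (c c' : Copy) :
    Form κ Δ :=
  exs1 ((List.range (S.arity I + 1)).map FOVar.y) <|
  and (inR κ Δ l (.var (.y 0))) <|
  and (bigAnd Finset.univ fun i : Fin (S.arity I) =>
    pathForm κ Δ l (v i) (.y 0) (.y (i + 1))) <|
  and (bigOr ((Finset.univ : Finset ((Fin (S.arity I) → β.State) ×
      (Fin (S.arity I) → β.State))).filter fun t => β.Sync I t.1 t.2) fun t =>
    bigAnd Finset.univ fun q : β.State => and
      (setEq κ Δ c q (Finset.univ.filter fun i => t.1 i = q))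
      (setEq κ Δ c' q (Finset.univ.filter fun i => t.2 i = q))) <|
  bigAnd ((Finset.univ : Finset (Fin (S.arity I) × Fin (S.arity I))).filter
      fun p => p.1 < p.2) fun p =>
    or (ne (.var (.y (p.1 + 1))) (.var (.y (p.2 + 1))))
      (const (S.compOf (S.iports I p.1) ≠ S.compOf (S.iports I p.2)))

/-- The flow formula `Φ`: the copies `c`, `c'` are the pre- and the post-set of a transition. -/
def flow (c c' : Copy) : Form κ Δ :=
  bigOr Finset.univ fun l => bigOr (Δ.rule l).body.interAtoms.toFinset fun a =>
    flowAtom κ Δ l a.1 a.2 c c'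

/-- `|A| ≥ n`, for the set `A` of all nodes `t` with `inA t`, where `inA` has no first-order
variables but those of `t`. -/
def cardGe (inA : WTerm κ FOVar → Form κ Δ) (n : ℕ) : Form κ Δ :=
  exs1 ((List.range n).map FOVar.y) <| and
    (bigAnd ((Finset.range n ×ˢ Finset.range n).filter fun p => p.1 < p.2) fun p =>
      ne (.var (.y p.1)) (.var (.y p.2)))
    (bigAnd (Finset.range n) fun i => inA (.var (.y i)))

/-- `|A| = n`. -/
def cardEq (inA : WTerm κ FOVar → Form κ Δ) (n : ℕ) : Form κ Δ :=
  and (cardGe κ Δ inA n) (neg (cardGe κ Δ inA (n + 1)))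

/-- Membership in `X⃗ ∩ Y⃗ = ⋃_q X_q ∩ Y_q`. -/
def inInter (c c' : Copy) (t : WTerm κ FOVar) : Form κ Δ :=
  bigOr Finset.univ fun q : β.State => and (inM κ Δ c q t) (inM κ Δ c' q t)

/-- `X⃗ ∩ Y⃗ ≠ ∅`. -/
def meets (c c' : Copy) : Form κ Δ := ex1 .x (inInter κ Δ c c' (.var .x))

/-- `|X⃗ ∩ Y⃗| = 1`. -/
def meetsOnce (c c' : Copy) : Form κ Δ := cardEq κ Δ (inInter κ Δ c c') 1

/-- `X⃗ ⊆ Y⃗`. -/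
def included (c c' : Copy) : Form κ Δ :=
  all1 .x (bigAnd Finset.univ fun q : β.State =>
    imp (inM κ Δ c q (.var .x)) (inM κ Δ c' q (.var .x)))

/-- `Init`. -/
def initForm (c : Copy) : Form κ Δ :=
  and (markForm κ Δ c) <|
  all1 .x (bigAnd Finset.univ fun q : β.State =>
    iff (inM κ Δ c q (.var .x))
      (bigOr (Finset.univ.filter fun l => ∃ v, (q, v) ∈ (Δ.rule l).body.stateAtoms) fun l =>
        inR κ Δ l (.var .x)))

/-- `θ`, for a copy `c` distinct from `YY` and `ZZ`. -/
def trapForm (c : Copy) : Form κ Δ :=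
  allM κ Δ .YY <| allM κ Δ .ZZ <|
    imp (flow κ Δ .YY .ZZ) (imp (meets κ Δ c .YY) (meets κ Δ c .ZZ))

/-- `Θ(X⃗, Y⃗, R⃗)`. -/
def trapInv : Form κ Δ :=
  and (markForm κ Δ .X) <| allM κ Δ .Z <|
    imp (and (meets κ Δ .Y .Z) (trapForm κ Δ .Z)) (meets κ Δ .X .Z)

/-- `ω`, for a copy `c` distinct from `YY` and `ZZ`. -/
def mutexForm (c : Copy) : Form κ Δ :=
  allM κ Δ .YY <| allM κ Δ .ZZ <|
    imp (flow κ Δ .YY .ZZ) <| and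
      (iff (neg (meets κ Δ c .YY)) (neg (meets κ Δ c .ZZ)))
      (iff (meetsOnce κ Δ c .YY) (meetsOnce κ Δ c .ZZ))

/-- `Ω(X⃗, Y⃗, R⃗)`. -/
def mutexInv : Form κ Δ :=
  and (markForm κ Δ .X) <| allM κ Δ .Z <|
    imp (and (meetsOnce κ Δ .Y .Z) (mutexForm κ Δ .Z)) (meetsOnce κ Δ .X .Z)

/-- `DeadLock(X⃗, R⃗)`. -/
def deadLock : Form κ Δ :=
  allM κ Δ .YY <| allM κ Δ .ZZ <|
    imp (flow κ Δ .YY .ZZ) (neg (included κ Δ .YY .X))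

/-- `ErrSet_{⟨q₁,…,qₙ⟩}(X⃗)`. -/
def errSet {n : ℕ} (q : Fin n → β.State) : Form κ Δ :=
  bigAnd Finset.univ fun p : β.State =>
    cardGe κ Δ (inM κ Δ .X p) (Finset.univ.filter fun i => q i = p).card

/-- `DeadLock ∧ Θ ∧ Ω ∧ Init ∧ RewrTree`. -/
def deadlockVC (r : Fin Δ.size) : Form κ Δ :=
  and (deadLock κ Δ) <| and (trapInv κ Δ) <| and (mutexInv κ Δ) <|
    and (initForm κ Δ .Y) (rewrTree κ Δ r)

/-- `ErrSet ∧ Θ ∧ Ω ∧ Init ∧ RewrTree`. -/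
def reachVC (r : Fin Δ.size) {n : ℕ} (q : Fin n → β.State) : Form κ Δ :=
  and (errSet κ Δ q) <| and (trapInv κ Δ) <| and (mutexInv κ Δ) <|
    and (initForm κ Δ .Y) (rewrTree κ Δ r)

end VC

end

end CBS

/-!
# Soundness of the verification conditions for deadlock and reachability

A model `c` of `φ` comes with a derivation, which is recorded as a finite tree `T` whose nodes carry
a rule and a store for all variables of its body (`Models.exists_isUnfolding`). The rules of `T`
interpret the variables `R_i`, and `RewrTree` holds. By the syntactic form of the rules a node has
at most one state atom, and because `*` composes disjoint configurations, two nodes never describe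
the same component. Hence `StoreTree.Hosts` is a bijection between the components of `c` and the
nodes with a state atom, and a set of places becomes a tuple of sets of nodes
(`StoreTree.image`). Precise markings are mapped to tuples that satisfy `Mark`, and the initial one
to the tuple described by `Init`.

The heart of the argument compares the transitions of the net with the solutions of the flow
formula.

* Every transition yields a flow (`StoreTree.IsUnfolding.isFlow`). By tightness, a variable of an
  interaction atom is passed down in the tree to a node that hosts a component of the type of the
  port, and the path automaton follows it (`StoreTree.IsUnfolding.exists_isRun`). Hence whatever is
  a trap or a mutex of all flows is one of all transitions, and induction on the firing sequence
  shows that a reachable marking satisfies `Θ` and `Ω` (`trap_reach`, `mutex_reach`).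
* The converse holds only in part. The arguments of a predicate atom may be repeated, so that the
  path automaton is not deterministic and a path may end in a component of another type than that
  of the port. The index of the component is right nevertheless, because the value of the tracked
  variable is constant along a path (`StoreTree.IsUnfolding.hosts_of_isPath`). When the pre-set of a
  flow is contained in a marking, the types are right as well, and the flow is a transition enabled
  in the marking (`StoreTree.IsUnfolding.exists_enabled`). This is all that `DeadLock` needs.

Thus a reachable deadlock, or a reachable marking that covers the given states, provides a
satisfying store for the corresponding condition (`exists_store`).
-/

namespace CBS

open scoped Classical

/-! ### Semantics of the derived connectives -/

namespace WForm

variable {κ : ℕ} {V W : Type} (ν : WStore κ V W)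

@[simp] lemma holds_eq (t₁ t₂ : WTerm κ V) :
    (eq t₁ t₂ : WForm κ V W).Holds ν ↔ t₁.eval ν.fo = t₂.eval ν.fo := Iff.rfl

@[simp] lemma holds_mem (X : W) (t : WTerm κ V) :
    (mem X t).Holds ν ↔ t.eval ν.fo ∈ ν.so X := Iff.rfl

@[simp] lemma holds_and (ξ₁ ξ₂ : WForm κ V W) :
    (and ξ₁ ξ₂).Holds ν ↔ ξ₁.Holds ν ∧ ξ₂.Holds ν := Iff.rfl

@[simp] lemma holds_neg (ξ : WForm κ V W) : (neg ξ).Holds ν ↔ ¬ ξ.Holds ν := Iff.rfl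

@[simp] lemma holds_ex1 (x : V) (ξ : WForm κ V W) :
    (ex1 x ξ).Holds ν ↔ ∃ w : Node κ, ξ.Holds { ν with fo := Function.update ν.fo x w } := Iff.rfl

@[simp] lemma holds_tt : (tt : WForm κ V W).Holds ν := by simp [tt]

@[simp] lemma holds_ff : ¬ (ff : WForm κ V W).Holds ν := by simp [ff]

@[simp] lemma holds_or (ξ₁ ξ₂ : WForm κ V W) :
    (or ξ₁ ξ₂).Holds ν ↔ ξ₁.Holds ν ∨ ξ₂.Holds ν := by simp [or]; tauto

@[simp] lemma holds_imp (ξ₁ ξ₂ : WForm κ V W) :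
    (imp ξ₁ ξ₂).Holds ν ↔ (ξ₁.Holds ν → ξ₂.Holds ν) := by simp [imp]; tauto

@[simp] lemma holds_iff (ξ₁ ξ₂ : WForm κ V W) :
    (iff ξ₁ ξ₂).Holds ν ↔ (ξ₁.Holds ν ↔ ξ₂.Holds ν) := by simp [iff]; tauto

@[simp] lemma holds_all1 (x : V) (ξ : WForm κ V W) :
    (all1 x ξ).Holds ν ↔ ∀ w : Node κ, ξ.Holds { ν with fo := Function.update ν.fo x w } := by
  simp [all1]

@[simp] lemma holds_ne (t₁ t₂ : WTerm κ V) :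
    (ne t₁ t₂ : WForm κ V W).Holds ν ↔ t₁.eval ν.fo ≠ t₂.eval ν.fo := Iff.rfl

@[simp] lemma holds_const (p : Prop) : (const p : WForm κ V W).Holds ν ↔ p := by
  unfold const; split_ifs <;> simp [*]

@[simp] lemma holds_bigAnd {ι : Type*} (s : Finset ι) (f : ι → WForm κ V W) :
    (bigAnd s f).Holds ν ↔ ∀ i ∈ s, (f i).Holds ν := by
  have h (l : List ι) : ((l.map f).foldr and tt).Holds ν ↔ ∀ i ∈ l, (f i).Holds ν := by
    induction l with
    | nil => simp
    | cons a l ih => simp [ih]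
  simp [bigAnd, h]

@[simp] lemma holds_bigOr {ι : Type*} (s : Finset ι) (f : ι → WForm κ V W) :
    (bigOr s f).Holds ν ↔ ∃ i ∈ s, (f i).Holds ν := by
  have h (l : List ι) : ((l.map f).foldr or ff).Holds ν ↔ ∃ i ∈ l, (f i).Holds ν := by
    induction l with
    | nil => simp
    | cons a l ih => simp [ih]
  simp [bigOr, h]

lemma holds_exs1 (xs : List V) (ξ : WForm κ V W) :
    (exs1 xs ξ).Holds ν ↔
      ∃ f : V → Node κ, (∀ x ∉ xs, f x = ν.fo x) ∧ ξ.Holds { ν with fo := f } := by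
  induction xs generalizing ν with
  | nil =>
    constructor
    · exact fun h => ⟨ν.fo, fun _ _ => rfl, h⟩
    · rintro ⟨f, hf, h⟩
      obtain rfl : f = ν.fo := funext fun x => hf x (by simp)
      exact h
  | cons a xs ih =>
    change (∃ w, (exs1 xs ξ).Holds _) ↔ _
    simp only [ih]
    constructor
    · rintro ⟨w, f, hf, h⟩
      refine ⟨f, fun x hx => ?_, h⟩
      simp only [List.mem_cons, not_or] at hx
      rw [hf x hx.2, Function.update_of_ne hx.1]
    · rintro ⟨f, hf, h⟩
      refine ⟨f a, f, fun x hx => ?_, h⟩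
      by_cases hxa : x = a
      · subst hxa; simp
      · rw [Function.update_of_ne hxa]; exact hf x (by simp [hxa, hx])

lemma holds_exs2 (Xs : List W) (ξ : WForm κ V W) :
    (exs2 Xs ξ).Holds ν ↔
      ∃ g : W → Finset (Node κ), (∀ X ∉ Xs, g X = ν.so X) ∧ ξ.Holds { ν with so := g } := by
  induction Xs generalizing ν with
  | nil =>
    constructor
    · exact fun h => ⟨ν.so, fun _ _ => rfl, h⟩
    · rintro ⟨f, hf, h⟩
      obtain rfl : f = ν.so := funext fun x => hf x (by simp)
      exact h
  | cons a xs ih =>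
    change (∃ w, (exs2 xs ξ).Holds _) ↔ _
    simp only [ih]
    constructor
    · rintro ⟨w, f, hf, h⟩
      refine ⟨f, fun x hx => ?_, h⟩
      simp only [List.mem_cons, not_or] at hx
      rw [hf x hx.2, Function.update_of_ne hx.1]
    · rintro ⟨f, hf, h⟩
      refine ⟨f a, f, fun x hx => ?_, h⟩
      by_cases hxa : x = a
      · subst hxa; simp
      · rw [Function.update_of_ne hxa]; exact hf x (by simp [hxa, hx])

lemma holds_alls2 (Xs : List W) (ξ : WForm κ V W) :
    (alls2 Xs ξ).Holds ν ↔
      ∀ g : W → Finset (Node κ), (∀ X ∉ Xs, g X = ν.so X) → ξ.Holds { ν with so := g } := by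
  have h : (alls2 Xs ξ).Holds ν ↔ ¬ (exs2 Xs (neg ξ)).Holds ν := by
    induction Xs generalizing ν with
    | nil => simp [alls2, exs2]
    | cons a Xs ih =>
      change ¬ (∃ A, ¬ (alls2 Xs ξ).Holds _) ↔ ¬ ∃ A, (exs2 Xs (neg ξ)).Holds _
      simp only [ih, not_not]
  rw [h, holds_exs2]
  simp

end WForm

@[simp] lemma WTerm.eval_eps {κ : ℕ} {V : Type} (f : V → Node κ) : WTerm.eps.eval f = [] := rfl

@[simp] lemma WTerm.eval_var {κ : ℕ} {V : Type} (f : V → Node κ) (x : V) :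
    (WTerm.var x).eval f = f x := rfl

@[simp] lemma WTerm.eval_succ {κ : ℕ} {V : Type} (f : V → Node κ) (t : WTerm κ V) (d : Fin κ) :
    (t.succ d).eval f = t.eval f ++ [d] := rfl

/-! ### Semantics of the path automata and of the flow formula -/

/-- The sets `Y s` label nodes by states and describe an accepting run from `x` down to `y`: these
are the conditions expressed by `PathAut.form`. -/
structure PathAut.IsRun {κ : ℕ} {σ : Type} (A : PathAut κ σ) (Y : σ → Finset (Node κ))
    (x y : Node κ) : Prop where
  disj : ∀ s ∈ A.states, ∀ t ∈ A.states, ∀ z ∈ Y s, z ∈ Y t → s = t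
  init : ∃ s ∈ A.init, x ∈ Y s
  final : ∃ s ∈ A.final, y ∈ Y s
  next : ∀ s ∈ A.states, ∀ z ∈ Y s, z ≠ y → ∃ t ∈ A.trans, t.1 = s ∧ z ++ [t.2.1] ∈ Y t.2.2
  prev : ∀ s ∈ A.states, ∀ z ∈ Y s, z ≠ x →
    ∃ t ∈ A.trans, t.2.2 = s ∧ ∃ z' ∈ Y t.1, z' ++ [t.2.1] = z

lemma PathAut.holds_form {κ : ℕ} {σ W : Type} (A : PathAut κ σ) (Y : σ → W) (i j : ℕ)
    (ν : WStore κ FOVar W) :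
    (A.form Y (.y i) (.y j)).Holds ν ↔
      A.IsRun (fun s => ν.so (Y s)) (ν.fo (.y i)) (ν.fo (.y j)) := by
  simp only [PathAut.form, WForm.holds_and, WForm.holds_bigAnd, WForm.holds_bigOr,
    WForm.holds_all1, WForm.holds_or, WForm.holds_neg, WForm.holds_mem, WForm.holds_imp,
    WForm.holds_ne, WForm.holds_ex1, WForm.holds_eq, WTerm.eval_var, WTerm.eval_succ,
    Finset.mem_filter, Finset.mem_product, ne_eq, reduceCtorEq, not_false_eq_true,
    Function.update_self, Function.update_of_ne, Prod.forall]
  constructor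
  · rintro ⟨h1, h2, h3, h4, h5⟩
    refine ⟨fun s hs t ht z hz hz' => ?_, h2, h3, fun s hs z hz hzy => ?_,
      fun s hs z hz hzx => ?_⟩
    · by_contra hst
      have := h1 s t ⟨⟨hs, ht⟩, hst⟩ z
      tauto
    · obtain ⟨t, ⟨ht, hts⟩, h⟩ := h4 s hs z ⟨hzy, hz⟩
      exact ⟨t, ht, hts, h⟩
    · obtain ⟨t, ⟨ht, hts⟩, z', h, h'⟩ := h5 s hs z ⟨hzx, hz⟩
      exact ⟨t, ht, hts, z', h', h⟩
  · rintro ⟨h1, h2, h3, h4, h5⟩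
    refine ⟨fun s t h z => ?_, h2, h3, fun s hs z h => ?_, fun s hs z h => ?_⟩
    · by_contra hc
      push Not at hc
      exact h.2 (h1 s h.1.1 t h.1.2 z hc.1 hc.2)
    · obtain ⟨t, ht, hts, h⟩ := h4 s hs z h.2 h.1
      exact ⟨t, ⟨ht, hts⟩, h⟩
    · obtain ⟨t, ht, hts, z', h, h'⟩ := h5 s hs z h.2 h.1
      exact ⟨t, ⟨ht, hts⟩, z', h', h⟩

section VC

open WForm

variable {S : Signature} {β : Behavior S} {κ : ℕ} (Δ : SID β)

/-- The meaning of `pathForm`, relative to a labeling `R` of nodes by rules. -/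
def IsPath (R : Fin Δ.size → Finset (Node κ)) (i : Fin Δ.size) (v : ℕ) (x y : Node κ) : Prop :=
  ∃ Y : Fin Δ.size × ℕ → Finset (Node κ), (pathAut κ Δ i v).IsRun Y x y ∧
    ∀ s ∈ autStates Δ, ∀ w ∈ Y s, w ∈ R s.1

/-- The meaning of `flow`, relative to a labeling `R` of nodes by rules: `X` and `X'` are the
pre- and the post-set of the synchronous firing of an interaction atom. -/
def IsFlow (R : Fin Δ.size → Finset (Node κ)) (X X' : β.State → Finset (Node κ)) : Prop :=
  ∃ l : Fin Δ.size, ∃ a ∈ (Δ.rule l).body.interAtoms,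
    ∃ (y₀ : Node κ) (y : Fin (S.arity a.1) → Node κ), y₀ ∈ R l ∧
      (∀ i, IsPath Δ R l (a.2 i) y₀ (y i)) ∧
      (∃ src dst : Fin (S.arity a.1) → β.State, β.Sync a.1 src dst ∧
        ∀ q w, (w ∈ X q ↔ ∃ i, src i = q ∧ w = y i) ∧ (w ∈ X' q ↔ ∃ i, dst i = q ∧ w = y i)) ∧
      ∀ i j, i < j → y i ≠ y j ∨ S.compOf (S.iports a.1 i) ≠ S.compOf (S.iports a.1 j)

/-- The labeling of nodes by rules that is given by a store. -/
def WStore.rules {P : ℕ} {Q : Type} (ν : WStore κ FOVar (SOVar P Q)) (i : Fin P) :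
    Finset (Node κ) := ν.so (.R i)

/-- The value in a store of the copy `c` of the tuple of sets indexed by states. -/
def WStore.tuple {P : ℕ} {Q : Type} (ν : WStore κ FOVar (SOVar P Q)) (c : Copy) (q : Q) :
    Finset (Node κ) := ν.so (.mk c q)

/-- The store in which the copy `c` of the tuple has the value `X`. -/
noncomputable def WStore.set {P : ℕ} {Q : Type} (ν : WStore κ FOVar (SOVar P Q)) (c : Copy)
    (X : Q → Finset (Node κ)) : WStore κ FOVar (SOVar P Q) where
  fo := ν.fo
  so := fun W => match W with
    | .mk c' q => if c' = c then X q else ν.so (.mk c' q)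
    | W => ν.so W

section set

variable {P : ℕ} {Q : Type} (ν : WStore κ FOVar (SOVar P Q))

@[simp] lemma WStore.rules_set (c : Copy) (X : Q → Finset (Node κ)) :
    (ν.set c X).rules = ν.rules := rfl

@[simp] lemma WStore.tuple_set_self (c : Copy) (X : Q → Finset (Node κ)) :
    (ν.set c X).tuple c = X := by
  ext q; simp [WStore.set, WStore.tuple]

@[simp] lemma WStore.tuple_set_of_ne {c c' : Copy} (h : c' ≠ c) (X : Q → Finset (Node κ)) :
    (ν.set c X).tuple c' = ν.tuple c' := by
  ext q; simp [WStore.set, WStore.tuple, h]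

end set

variable (ν : WStore κ FOVar (SOVar Δ.size β.State))

lemma holds_allM (c : Copy) (ξ : Form κ Δ) :
    (allM κ Δ c ξ).Holds ν ↔ ∀ X, ξ.Holds (ν.set c X) := by
  rw [allM, holds_alls2]
  constructor
  · intro h X
    refine h (ν.set c X).so fun W hW => ?_
    cases W with
    | mk c' q =>
      have : c' ≠ c := by rintro rfl; simp at hW
      simp [WStore.set, this]
    | _ => rfl
  · intro h g hg
    have := h fun q => g (.mk c q)
    convert this using 1
    simp only [WStore.set, WStore.mk.injEq, true_and]
    ext1 W
    cases W with
    | mk c' q =>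
      by_cases hc : c' = c
      · simp [hc]
      · simp only [hc, if_false]
        exact hg _ (by simp [Ne.symm hc])
    | _ => exact hg _ (by simp)

variable {Δ} in
lemma PathAut.IsRun.congr {l : Fin Δ.size} {v : ℕ} (hv : (l, v) ∈ autStates Δ)
    {Y Y' : Fin Δ.size × ℕ → Finset (Node κ)} (hY : ∀ s ∈ autStates Δ, Y s = Y' s)
    {x y : Node κ} (h : (pathAut κ Δ l v).IsRun Y x y) : (pathAut κ Δ l v).IsRun Y' x y where
  disj s hs t ht := by rw [← hY s hs, ← hY t ht]; exact h.disj s hs t ht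
  init := by
    obtain ⟨s, hs, hx⟩ := h.init
    obtain rfl : s = (l, v) := by simpa [pathAut] using hs
    exact ⟨_, hs, hY _ hv ▸ hx⟩
  final := by
    obtain ⟨s, hs, hx⟩ := h.final
    exact ⟨s, hs, hY s (Finset.mem_filter.1 hs).1 ▸ hx⟩
  next s hs z hz hzy := by
    obtain ⟨t, ht, hts, hm⟩ := h.next s hs z (by rwa [hY s hs]) hzy
    refine ⟨t, ht, hts, ?_⟩
    rwa [← hY]
    simp only [pathAut, Finset.mem_filter, Finset.mem_product] at ht
    exact ht.1.2.2
  prev s hs z hz hzx := by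
    obtain ⟨t, ht, hts, hm⟩ := h.prev s hs z (by rwa [hY s hs]) hzx
    refine ⟨t, ht, hts, ?_⟩
    rwa [← hY]
    simp only [pathAut, Finset.mem_filter, Finset.mem_product] at ht
    exact ht.1.1

/-- The hypothesis `hv` matters because the formula quantifies only over the sets of the states in
`autStates`: the set of an initial state outside of these would be free in it. -/
lemma holds_pathForm {l : Fin Δ.size} {v : ℕ} (hv : (l, v) ∈ autStates Δ) (i j : ℕ) :
    (pathForm κ Δ l v (.y i) (.y j)).Holds ν ↔
      IsPath Δ ν.rules l v (ν.fo (.y i)) (ν.fo (.y j)) := by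
  rw [pathForm, holds_exs2]
  simp only [holds_and, PathAut.holds_form, upsilon, holds_bigAnd, holds_all1, holds_imp,
    holds_mem, inR, WTerm.eval_var, Function.update_self]
  constructor
  · rintro ⟨g, hg, h, h'⟩
    refine ⟨_, h, fun s hs w hw => ?_⟩
    have := h' s hs w hw
    rwa [hg _ (by simp [runVar])] at this
  · rintro ⟨Y, h, h'⟩
    refine ⟨fun W => match W with
      | .run i v => if (i, v) ∈ autStates Δ then Y (i, v) else ν.so (.run i v)
      | W => ν.so W, fun W hW => ?_, h.congr hv fun s hs => ?_, fun s hs w hw => ?_⟩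
    · cases W with
      | run i v =>
        have : (i, v) ∉ autStates Δ := fun hm =>
          hW (List.mem_map.2 ⟨(i, v), by simpa using hm, rfl⟩)
        simp [this]
      | _ => rfl
    · simp [runVar, hs]
    · simp only [runVar, hs, if_true] at hw
      exact h' s hs w hw

lemma CL.mem_vars_of_mem_interAtoms {ψ : CL β} {a} (ha : a ∈ ψ.interAtoms) (k) :
    a.2 k ∈ ψ.vars := by
  induction ψ with
  | inter I x => simp only [interAtoms, List.mem_singleton] at ha; subst ha; simp [vars]
  | star φ ψ h h' =>
    simp only [interAtoms, List.mem_append] at ha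
    simp only [vars, Finset.mem_union]
    exact ha.imp h h'
  | ex x φ h => exact h ha
  | _ => simp [interAtoms] at ha

lemma CL.mem_vars_of_mem_predAtoms {ψ : CL β} {a} (ha : a ∈ ψ.predAtoms) (k) :
    a.2 k ∈ ψ.vars := by
  induction ψ with
  | pred I x => simp only [predAtoms, List.mem_singleton] at ha; subst ha; simp [vars]
  | star φ ψ h h' =>
    simp only [predAtoms, List.mem_append] at ha
    simp only [vars, Finset.mem_union]
    exact ha.imp h h'
  | ex x φ h => exact h ha
  | _ => simp [predAtoms] at ha

lemma CL.mem_vars_of_mem_stateAtoms {ψ : CL β} {a} (ha : a ∈ ψ.stateAtoms) :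
    a.2 ∈ ψ.vars := by
  induction ψ with
  | compAt I x => simp only [stateAtoms, List.mem_singleton] at ha; subst ha; simp [vars]
  | star φ ψ h h' =>
    simp only [stateAtoms, List.mem_append] at ha
    simp only [vars, Finset.mem_union]
    exact ha.imp h h'
  | ex x φ h => exact h ha
  | _ => simp [stateAtoms] at ha

variable {Δ} in
lemma mem_autStates {l : Fin Δ.size} {v : ℕ} :
    (l, v) ∈ autStates Δ ↔ v ∈ (Δ.rule l).body.vars := by
  simp [autStates]

lemma holds_setEq (c : Copy) (q : β.State) {k : ℕ} (s : Finset (Fin k)) :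
    (setEq κ Δ c q s).Holds ν ↔ ∀ w, w ∈ ν.tuple c q ↔ ∃ i ∈ s, w = ν.fo (.y (i + 1)) := by
  simp [setEq, inM, WStore.tuple]

lemma holds_flowAtom {l : Fin Δ.size} {I : S.Inter} {v : Fin (S.arity I) → ℕ}
    (hv : ∀ k, (l, v k) ∈ autStates Δ) (c c' : Copy) :
    (flowAtom κ Δ l I v c c').Holds ν ↔
      ∃ (y₀ : Node κ) (y : Fin (S.arity I) → Node κ), y₀ ∈ ν.rules l ∧
      (∀ i, IsPath Δ ν.rules l (v i) y₀ (y i)) ∧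
      (∃ src dst : Fin (S.arity I) → β.State, β.Sync I src dst ∧
        ∀ q w, (w ∈ ν.tuple c q ↔ ∃ i, src i = q ∧ w = y i) ∧
          (w ∈ ν.tuple c' q ↔ ∃ i, dst i = q ∧ w = y i)) ∧
      ∀ i j, i < j → y i ≠ y j ∨ S.compOf (S.iports I i) ≠ S.compOf (S.iports I j) := by
  rw [flowAtom, holds_exs1]
  simp only [holds_and, holds_bigAnd, holds_bigOr, holds_pathForm _ _ (hv _), holds_setEq,
    holds_or, holds_ne, holds_const, WTerm.eval_var, inR, holds_mem, Finset.mem_filter,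
    Finset.mem_univ, true_and, forall_const, Prod.exists, Prod.forall, ← forall_and]
  constructor
  · rintro ⟨f, -, h0, h1, h2, h3⟩
    exact ⟨f (.y 0), fun i => f (.y (i + 1)), h0, h1, h2, h3⟩
  · rintro ⟨y₀, y, h0, h1, h2, h3⟩
    refine ⟨fun u => match u with
      | .y 0 => y₀
      | .y (i + 1) => if h : i < S.arity I then y ⟨i, h⟩ else ν.fo (.y (i + 1))
      | u => ν.fo u, fun u hu => ?_, ?_⟩
    · cases u with
      | y i =>
        cases i with
        | zero => simp at hu
        | succ i =>
          have : ¬ i < S.arity I := fun h =>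
            hu (List.mem_map.2 ⟨i + 1, List.mem_range.2 (by omega), rfl⟩)
          simp [this]
      | _ => rfl
    · simp only [Fin.is_lt, dite_true, Fin.eta]
      exact ⟨h0, h1, h2, h3⟩

lemma holds_flow (c c' : Copy) :
    (flow κ Δ c c').Holds ν ↔ IsFlow Δ ν.rules (ν.tuple c) (ν.tuple c') := by
  simp only [flow, holds_bigOr, Finset.mem_univ, true_and, List.mem_toFinset, IsFlow]
  refine exists_congr fun l => exists_congr fun a => and_congr_right fun ha => ?_
  exact holds_flowAtom Δ ν
    (fun k => mem_autStates.2 (CL.mem_vars_of_mem_interAtoms ha k)) c c'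

/-! ### Semantics of the verification conditions -/

lemma holds_cardGe (inA : WTerm κ FOVar → Form κ Δ) (A : Finset (Node κ))
    (h : ∀ f t, (inA t).Holds { ν with fo := f } ↔ t.eval f ∈ A) (n : ℕ) :
    (cardGe κ Δ inA n).Holds ν ↔ n ≤ A.card := by
  rw [cardGe, holds_exs1]
  simp only [holds_and, holds_bigAnd, holds_ne, WTerm.eval_var, Finset.mem_filter,
    Finset.mem_product, Finset.mem_range, Prod.forall, h]
  constructor
  · rintro ⟨f, -, h1, h2⟩
    have := Finset.card_le_card_of_injOn (s := Finset.range n) (t := A) (fun i => f (.y i))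
      (fun i hi => h2 i (Finset.mem_range.1 hi)) (fun i hi j hj hij => ?_)
    · simpa using this
    · have hi := Finset.mem_range.1 hi
      have hj := Finset.mem_range.1 hj
      rcases lt_trichotomy i j with h | h | h
      · exact absurd hij (h1 i j ⟨⟨hi, hj⟩, h⟩)
      · exact h
      · exact absurd hij.symm (h1 j i ⟨⟨hj, hi⟩, h⟩)
  · intro hn
    obtain ⟨g⟩ : Nonempty (Fin n ↪ A) := Function.Embedding.nonempty_of_card_le (by simpa)
    refine ⟨fun u => match u with
      | .y i => if h : i < n then g ⟨i, h⟩ else ν.fo (.y i)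
      | u => ν.fo u, fun u hu => ?_, fun i j hij => ?_, fun i hi => ?_⟩
    · cases u with
      | y i =>
        have : ¬ i < n := fun h => hu (List.mem_map.2 ⟨i, List.mem_range.2 h, rfl⟩)
        simp [this]
      | _ => rfl
    · simp only [hij.1.1, hij.1.2, dite_true]
      intro he
      have := g.injective (Subtype.ext he)
      simp only [Fin.mk.injEq] at this
      omega
    · simp only [hi, dite_true]
      exact (g ⟨i, hi⟩).2

/-- The intersection of two tuples of sets of nodes. It consists of nodes, not of pairs of a node
and a state, so that its cardinality counts places only when each node belongs to at most one of the
sets `X q`. -/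
noncomputable def isect (X Z : β.State → Finset (Node κ)) : Finset (Node κ) :=
  Finset.univ.biUnion fun q => X q ∩ Z q

lemma mem_isect {X Z : β.State → Finset (Node κ)} {w : Node κ} :
    w ∈ isect X Z ↔ ∃ q, w ∈ X q ∧ w ∈ Z q := by
  simp [isect]

lemma holds_inInter (c c' : Copy) (t : WTerm κ FOVar) :
    (inInter κ Δ c c' t).Holds ν ↔ t.eval ν.fo ∈ isect (ν.tuple c) (ν.tuple c') := by
  simp [inInter, inM, mem_isect, WStore.tuple]

lemma holds_meets (c c' : Copy) :
    (meets κ Δ c c').Holds ν ↔ (isect (ν.tuple c) (ν.tuple c')).Nonempty := by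
  rw [meets, holds_ex1]
  refine exists_congr fun w => (holds_inInter Δ _ c c' _).trans ?_
  simp only [WTerm.eval_var, Function.update_self]
  rfl

lemma holds_meetsOnce (c c' : Copy) :
    (meetsOnce κ Δ c c').Holds ν ↔ (isect (ν.tuple c) (ν.tuple c')).card = 1 := by
  have h := holds_cardGe Δ ν (inInter κ Δ c c') (isect (ν.tuple c) (ν.tuple c'))
    (fun f t => holds_inInter Δ _ c c' t)
  simp only [meetsOnce, cardEq, holds_and, holds_neg, h]
  omega

lemma holds_included (c c' : Copy) :
    (included κ Δ c c').Holds ν ↔ ∀ q, ν.tuple c q ⊆ ν.tuple c' q := by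
  simp only [included, holds_all1, holds_bigAnd, Finset.mem_univ, forall_const, holds_imp, inM,
    holds_mem, WTerm.eval_var, Function.update_self, WStore.tuple]
  exact forall_comm

/-- The tuple `Z` of sets of nodes is a trap: every flow that starts in it also ends in it. -/
def IsTrap (R : Fin Δ.size → Finset (Node κ)) (Z : β.State → Finset (Node κ)) : Prop :=
  ∀ Y Y', IsFlow Δ R Y Y' → (isect Z Y).Nonempty → (isect Z Y').Nonempty

/-- The tuple `Z` of sets of nodes is a mutex: every flow meets it in no node before and after, or
in exactly one node before and after, or in more than one node before and after. -/
def IsMutex (R : Fin Δ.size → Finset (Node κ)) (Z : β.State → Finset (Node κ)) : Prop :=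
  ∀ Y Y', IsFlow Δ R Y Y' → ((isect Z Y = ∅ ↔ isect Z Y' = ∅) ∧
    ((isect Z Y).card = 1 ↔ (isect Z Y').card = 1))

lemma holds_trapForm : (trapForm κ Δ .Z).Holds ν ↔ IsTrap Δ ν.rules (ν.tuple .Z) := by
  simp only [trapForm, holds_allM, holds_imp, holds_flow, holds_meets, WStore.rules_set,
    WStore.tuple_set_self, ne_eq, reduceCtorEq, not_false_eq_true, WStore.tuple_set_of_ne]
  rfl

lemma holds_mutexForm : (mutexForm κ Δ .Z).Holds ν ↔ IsMutex Δ ν.rules (ν.tuple .Z) := by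
  simp only [mutexForm, holds_allM, holds_imp, holds_flow, holds_meets, WStore.rules_set,
    WStore.tuple_set_self, ne_eq, reduceCtorEq, not_false_eq_true, WStore.tuple_set_of_ne,
    holds_and, holds_iff, holds_neg, holds_meetsOnce, Finset.not_nonempty_iff_eq_empty]
  rfl

/-- The tuple `X` is a precise marking of the tree labeled by `R`. -/
def IsMark (R : Fin Δ.size → Finset (Node κ)) (X : β.State → Finset (Node κ)) : Prop :=
  ∀ w C, (∀ q q', q ≠ q' → β.comp q = C → β.comp q' = C → w ∉ X q ∨ w ∉ X q') ∧
    ((∃ q, β.comp q = C ∧ w ∈ X q) ↔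
      ∃ j, (∃ a ∈ (Δ.rule j).body.stateAtoms, β.comp a.1 = C) ∧ w ∈ R j)

lemma holds_markForm (c : Copy) :
    (markForm κ Δ c).Holds ν ↔ IsMark Δ ν.rules (ν.tuple c) := by
  simp only [markForm, holds_all1, holds_bigAnd, holds_and, holds_or, holds_neg, inM, inR,
    holds_mem, holds_iff, holds_bigOr, Finset.mem_filter, Finset.mem_univ, true_and,
    forall_const, Prod.forall, WTerm.eval_var, Function.update_self, and_imp]
  rfl

lemma holds_trapInv : (trapInv κ Δ).Holds ν ↔ IsMark Δ ν.rules (ν.tuple .X) ∧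
    ∀ Z, (isect (ν.tuple .Y) Z).Nonempty → IsTrap Δ ν.rules Z →
      (isect (ν.tuple .X) Z).Nonempty := by
  simp only [trapInv, holds_and, holds_markForm, holds_allM, holds_imp, holds_meets,
    holds_trapForm, WStore.rules_set, WStore.tuple_set_self, ne_eq, reduceCtorEq,
    not_false_eq_true, WStore.tuple_set_of_ne, and_imp]

lemma holds_mutexInv : (mutexInv κ Δ).Holds ν ↔ IsMark Δ ν.rules (ν.tuple .X) ∧
    ∀ Z, (isect (ν.tuple .Y) Z).card = 1 → IsMutex Δ ν.rules Z →
      (isect (ν.tuple .X) Z).card = 1 := by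
  simp only [mutexInv, holds_and, holds_markForm, holds_allM, holds_imp, holds_meetsOnce,
    holds_mutexForm, WStore.rules_set, WStore.tuple_set_self, ne_eq, reduceCtorEq,
    not_false_eq_true, WStore.tuple_set_of_ne, and_imp]

lemma holds_deadLock : (deadLock κ Δ).Holds ν ↔
    ∀ Y Y', IsFlow Δ ν.rules Y Y' → ¬ ∀ q, Y q ⊆ ν.tuple .X q := by
  simp only [deadLock, holds_allM, holds_imp, holds_flow, holds_neg, holds_included,
    WStore.rules_set, WStore.tuple_set_self, ne_eq, reduceCtorEq,
    not_false_eq_true, WStore.tuple_set_of_ne]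

lemma holds_errSet {n : ℕ} (q : Fin n → β.State) : (errSet κ Δ q).Holds ν ↔
    ∀ p, (Finset.univ.filter fun i => q i = p).card ≤ (ν.tuple .X p).card := by
  simp only [errSet, holds_bigAnd, Finset.mem_univ, forall_const]
  exact forall_congr' fun p => holds_cardGe Δ ν _ _ (fun f t => Iff.rfl) _

lemma holds_initForm (c : Copy) : (initForm κ Δ c).Holds ν ↔ IsMark Δ ν.rules (ν.tuple c) ∧
    ∀ w q, w ∈ ν.tuple c q ↔
      ∃ l, (∃ v, (q, v) ∈ (Δ.rule l).body.stateAtoms) ∧ w ∈ ν.rules l := by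
  simp only [initForm, holds_and, holds_markForm, holds_all1, holds_bigAnd, Finset.mem_univ,
    forall_const, holds_iff, inM, inR, holds_mem, holds_bigOr, Finset.mem_filter, true_and,
    WTerm.eval_var, Function.update_self]
  rfl

/-- The sets `R i` are the sets of nodes labeled by the rules of a rewriting tree whose root is
labeled by the rule `r`. -/
structure IsRewrTree (R : Fin Δ.size → Finset (Node κ)) (r : Fin Δ.size) : Prop where
  disj : ∀ i j, i < j → ∀ w, w ∉ R i ∨ w ∉ R j
  root : ∀ w, w ∈ R r ↔ w = []
  parent : ∀ w d i, w ++ [d] ∈ R i → ∃ j, w ∈ R j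
  child : ∀ w i, w ∈ R i → ∀ d : Fin κ, d.val < (Δ.rule i).body.npred → ∃ l,
    ((Δ.rule i).body.predAtoms.map Sigma.fst)[d.val]? = some (Δ.rule l).head ∧ w ++ [d] ∈ R l
  leaf : ∀ w i, w ∈ R i → ∀ d : Fin κ, (Δ.rule i).body.npred ≤ d.val → ∀ l, w ++ [d] ∉ R l

variable {ν} in
lemma IsRewrTree.holds {r : Fin Δ.size} (h : IsRewrTree Δ ν.rules r) :
    (rewrTree κ Δ r).Holds ν := by
  simp only [rewrTree, holds_and, holds_all1, holds_bigAnd, holds_or, holds_neg, inR, holds_mem,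
    holds_iff, holds_bigOr, Finset.mem_filter, Finset.mem_univ, true_and, forall_const,
    Prod.forall, WTerm.eval_var, WTerm.eval_succ, WTerm.eval_eps, Function.update_self,
    holds_imp, holds_eq]
  exact ⟨fun w => ⟨fun i j hij => h.disj i j hij w, h.root w⟩,
    fun w i d hw => h.parent w d i hw, fun w i d hd hw => h.child w i hw d hd,
    fun w i d hd hw => h.leaf w i hw d hd⟩

end VC

/-! ### Shape of the rules -/

section Rules

variable {S : Signature} {β : Behavior S}

namespace CL

@[simp] lemma exs_cons (y : ℕ) (ys : List ℕ) (M : CL β) :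
    exs (y :: ys) M = ex y (exs ys M) := rfl

@[simp] lemma stateAtoms_exs (ys : List ℕ) (M : CL β) :
    (exs ys M).stateAtoms = M.stateAtoms := by
  induction ys with
  | nil => rfl
  | cons y ys ih => exact ih

@[simp] lemma interAtoms_exs (ys : List ℕ) (M : CL β) :
    (exs ys M).interAtoms = M.interAtoms := by
  induction ys with
  | nil => rfl
  | cons y ys ih => exact ih

@[simp] lemma predAtoms_exs (ys : List ℕ) (M : CL β) :
    (exs ys M).predAtoms = M.predAtoms := by
  induction ys with
  | nil => rfl
  | cons y ys ih => exact ih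

lemma notMem_of_mem_fv_exs {ys : List ℕ} {M : CL β} {v : ℕ} (h : v ∈ (exs ys M).fv) :
    v ∉ ys := by
  induction ys with
  | nil => simp
  | cons y ys ih =>
    simp only [exs_cons, fv, Finset.mem_erase] at h
    simp [h.1, ih h.2]

end CL

/-- The formula `ψ` is the prenex formula with quantified variables `ys` and matrix `M`, and all its
component atoms fix the state of the component. -/
def CL.IsPrenex (ψ : CL β) (ys : List ℕ) (M : CL β) : Prop :=
  ψ = CL.exs ys M ∧ M.QFree ∧ M.plainAtoms = []

variable {Δ : SID β} (hΔ : Δ.IsStandard)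

include hΔ

lemma SID.IsStandard.exists_isPrenex (i : Fin Δ.size) :
    ∃ ys M, (Δ.rule i).body.IsPrenex ys M := by
  rcases (hΔ i).2 with h | ⟨ys, M, h1, h2, h3, -⟩
  · exact ⟨[], _, rfl, h.2.1, h.2.2.1⟩
  · exact ⟨ys, M, h1, h2, h3⟩

/-- A rule body has at most one state atom, so that a node of a rewriting tree describes at most one
component. -/
lemma SID.IsStandard.stateAtoms_unique {i : Fin Δ.size} {a a' : β.State × ℕ}
    (ha : a ∈ (Δ.rule i).body.stateAtoms) (ha' : a' ∈ (Δ.rule i).body.stateAtoms) : a = a' := by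
  rcases (hΔ i).2 with ⟨-, -, -, -, -, q, k, h⟩ | ⟨ys, M, h1, -, -, -, h, -⟩
  · simp_all
  · rw [h1, CL.stateAtoms_exs] at ha ha'
    rcases h with h | ⟨q, _, h⟩ <;> simp_all

end Rules

/-! ### Rewriting trees of models -/

section Trees

variable {S : Signature} {β : Behavior S} {U : Type*} {κ : ℕ} (Δ : SID β)

/-- A finite tree whose nodes are labeled by a rule and a store that interprets all variables of
the body of the rule, the quantified ones included. -/
abbrev StoreTree (κ : ℕ) {S : Signature} {β : Behavior S} (Δ : SID β) (U : Type*) :=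
  Node κ → Option (Fin Δ.size × (ℕ → U))

/-- The rule `i` and the store `s` can be used to unfold the predicate atom `A(u)`. -/
def Unfolds (A : PredSym) (u : Fin A.arity → U) (p : Fin Δ.size × (ℕ → U)) : Prop :=
  ∃ h : A = (Δ.rule p.1).head, ∀ j : Fin A.arity,
    p.2 ((Δ.rule p.1).params (Fin.cast (congrArg PredSym.arity h) j)) = u j

variable {Δ} in
/-- The tree `T` is a complete unfolding of the predicate atom `A(u)` and `c` is the configuration
described by the component and interaction atoms at its nodes. -/
structure StoreTree.IsUnfolding (T : StoreTree κ Δ U) (c : Config β U) (A : PredSym)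
    (u : Fin A.arity → U) : Prop where
  root : ∃ p, T [] = some p ∧ Unfolds Δ A u p
  child : ∀ {w p}, T w = some p → ∀ {d : Fin κ} {b},
    (Δ.rule p.1).body.predAtoms[d.val]? = some b →
      ∃ p', T (w ++ [d]) = some p' ∧ Unfolds Δ b.1 (fun j => p.2 (b.2 j)) p'
  leaf : ∀ {w p}, T w = some p → ∀ {d : Fin κ},
    (Δ.rule p.1).body.predAtoms[d.val]? = none → T (w ++ [d]) = none
  parent : ∀ {w d p}, T (w ++ [d]) = some p → ∃ p', T w = some p'
  finite : {w | T w ≠ none}.Finite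
  comp : ∀ C x, x ∈ c.arch.comp C ↔ ∃ w p, T w = some p ∧
    ∃ a ∈ (Δ.rule p.1).body.stateAtoms, β.comp a.1 = C ∧ p.2 a.2 = x
  inter : ∀ I x, x ∈ c.arch.inter I ↔ ∃ w p, T w = some p ∧
    ∃ a : Fin (S.arity I) → ℕ, ⟨I, a⟩ ∈ (Δ.rule p.1).body.interAtoms ∧ (fun k => p.2 (a k)) = x
  mark : ∀ q x, (q, x) ∈ c.mark ↔ ∃ w p, T w = some p ∧
    ∃ v, (q, v) ∈ (Δ.rule p.1).body.stateAtoms ∧ p.2 v = x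
  inj : ∀ {w p a w' p' a'}, T w = some p → a ∈ (Δ.rule p.1).body.stateAtoms →
    T w' = some p' → a' ∈ (Δ.rule p'.1).body.stateAtoms → β.comp a.1 = β.comp a'.1 →
    p.2 a.2 = p'.2 a'.2 → w = w'

variable {Δ} in
/-- The configuration `c` is the composition of what the component and interaction atoms of `M`
describe under the store `s` and of configurations obtained by unfolding its predicate atoms. -/
structure IsForest (Fs : List (StoreTree κ Δ U × Config β U)) (c : Config β U) (s : ℕ → U)
    (M : CL β) : Prop where
  trees : List.Forall₂ (fun b F => F.1.IsUnfolding F.2 b.1 fun j => s (b.2 j)) M.predAtoms Fs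
  comp : ∀ C x, x ∈ c.arch.comp C ↔
    (∃ a ∈ M.stateAtoms, β.comp a.1 = C ∧ s a.2 = x) ∨ ∃ F ∈ Fs, x ∈ F.2.arch.comp C
  inter : ∀ I x, x ∈ c.arch.inter I ↔
    (∃ a : Fin (S.arity I) → ℕ, ⟨I, a⟩ ∈ M.interAtoms ∧ (fun k => s (a k)) = x) ∨
      ∃ F ∈ Fs, x ∈ F.2.arch.inter I
  mark : ∀ q x, (q, x) ∈ c.mark ↔
    (∃ v, (q, v) ∈ M.stateAtoms ∧ s v = x) ∨ ∃ F ∈ Fs, (q, x) ∈ F.2.mark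
  disj : Fs.Pairwise fun F G => ∀ C, Disjoint (F.2.arch.comp C) (G.2.arch.comp C)
  fresh : ∀ a ∈ M.stateAtoms, ∀ F ∈ Fs, s a.2 ∉ F.2.arch.comp (β.comp a.1)

lemma IsForest.star {Fs Gs : List (StoreTree κ Δ U × Config β U)} {c c₁ c₂ : Config β U}
    {s : ℕ → U} {φ ψ : CL β} (hc : c.IsComposition c₁ c₂) (h₁ : IsForest Fs c₁ s φ)
    (h₂ : IsForest Gs c₂ s ψ) : IsForest (Fs ++ Gs) c s (CL.star φ ψ) := by
  obtain ⟨hd, -, hC, hI, hm⟩ := hc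
  refine ⟨List.rel_append h₁.trees h₂.trees, fun C x => ?_, fun I x => ?_, fun q x => ?_, ?_, ?_⟩
  · rw [hC, Set.mem_union, h₁.comp, h₂.comp]
    simp only [CL.stateAtoms, List.mem_append, or_and_right, exists_or]
    exact or_or_or_comm
  · rw [hI, Set.mem_union, h₁.inter, h₂.inter]
    simp only [CL.interAtoms, List.mem_append, or_and_right, exists_or]
    exact or_or_or_comm
  · rw [hm, Set.mem_union, h₁.mark, h₂.mark]
    simp only [CL.stateAtoms, List.mem_append, or_and_right, exists_or]
    exact or_or_or_comm
  · refine List.pairwise_append.2 ⟨h₁.disj, h₂.disj, fun F hF G hG C => ?_⟩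
    exact (hd C).mono (fun x hx => (h₁.comp C x).2 (Or.inr ⟨F, hF, hx⟩))
      (fun x hx => (h₂.comp C x).2 (Or.inr ⟨G, hG, hx⟩))
  · intro a ha F hF hx
    simp only [CL.stateAtoms, List.mem_append] at ha hF
    rcases ha with ha | ha <;> rcases hF with hF | hF
    · exact h₁.fresh a ha F hF hx
    · exact Set.disjoint_left.1 (hd _) ((h₁.comp _ _).2 (Or.inl ⟨a, ha, rfl, rfl⟩))
        ((h₂.comp _ _).2 (Or.inr ⟨F, hF, hx⟩))
    · exact Set.disjoint_left.1 (hd _) ((h₁.comp _ _).2 (Or.inr ⟨F, hF, hx⟩))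
        ((h₂.comp _ _).2 (Or.inl ⟨a, ha, rfl, rfl⟩))
    · exact h₂.fresh a ha F hF hx

/-- The tree with root label `p` and immediate subtrees `Fs`. -/
def StoreTree.graft {Δ : SID β} (p : Fin Δ.size × (ℕ → U))
    (Fs : List (StoreTree κ Δ U × Config β U)) : StoreTree κ Δ U
  | [] => some p
  | d :: w => Fs[d.val]?.bind fun F => F.1 w

variable {Δ}

lemma StoreTree.graft_cons_eq_some {p p' : Fin Δ.size × (ℕ → U)}
    {Fs : List (StoreTree κ Δ U × Config β U)} {d : Fin κ} {w : Node κ} :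
    graft p Fs (d :: w) = some p' ↔ ∃ F, Fs[d.val]? = some F ∧ F.1 w = some p' := by
  simp [graft, Option.bind_eq_some_iff]

/-- The nodes of a grafted tree are its root and the nodes of the subtrees. The bound on the number
of subtrees ensures that none is lost for want of a direction. -/
lemma StoreTree.exists_graft {p : Fin Δ.size × (ℕ → U)}
    {Fs : List (StoreTree κ Δ U × Config β U)} (hκ : Fs.length ≤ κ)
    (P : Fin Δ.size × (ℕ → U) → Prop) :
    (∃ w p', graft p Fs w = some p' ∧ P p') ↔
      P p ∨ ∃ F ∈ Fs, ∃ w p', F.1 w = some p' ∧ P p' := by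
  constructor
  · rintro ⟨_ | ⟨d, w⟩, p', h, hp⟩
    · obtain rfl : p = p' := by simpa [graft] using h
      exact Or.inl hp
    · obtain ⟨F, hF, h⟩ := graft_cons_eq_some.1 h
      exact Or.inr ⟨F, List.mem_of_getElem? hF, w, p', h, hp⟩
  · rintro (hp | ⟨F, hF, w, p', h, hp⟩)
    · exact ⟨[], p, rfl, hp⟩
    · obtain ⟨d, hd, rfl⟩ := List.getElem_of_mem hF
      exact ⟨⟨d, hd.trans_le hκ⟩ :: w, p', graft_cons_eq_some.2 ⟨_, by simp [hd], h⟩, hp⟩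

/-- Grafting a forest for the body of a rule onto a root labeled by that rule. -/
lemma IsForest.isUnfolding_graft (hκ : ∀ i, (Δ.rule i).body.npred ≤ κ)
    {Fs : List (StoreTree κ Δ U × Config β U)} {c : Config β U} {A : PredSym}
    {u : Fin A.arity → U} {p : Fin Δ.size × (ℕ → U)} (hp : Unfolds Δ A u p)
    (h : IsForest Fs c p.2 (Δ.rule p.1).body) :
    (StoreTree.graft p Fs).IsUnfolding c A u := by
  have hlen : (Δ.rule p.1).body.predAtoms.length = Fs.length := h.trees.length_eq
  have hlκ : Fs.length ≤ κ := hlen ▸ hκ p.1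
  have htree : ∀ {d : ℕ} {F}, Fs[d]? = some F → ∃ b,
      (Δ.rule p.1).body.predAtoms[d]? = some b ∧
        F.1.IsUnfolding F.2 b.1 fun j => p.2 (b.2 j) := by
    intro d F hF
    obtain ⟨hd, rfl⟩ := List.getElem?_eq_some_iff.1 hF
    have hd' : d < (Δ.rule p.1).body.predAtoms.length := by omega
    exact ⟨_, List.getElem?_eq_getElem hd', h.trees.get hd' hd⟩
  refine ⟨⟨p, rfl, hp⟩, ?_, ?_, ?_, ?_, fun C x => ?_, fun I x => ?_, fun q x => ?_, ?_⟩
  · rintro (_ | ⟨e, w⟩) p' hp' d b hb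
    · obtain rfl : p = p' := by simpa [StoreTree.graft] using hp'
      obtain ⟨hd, rfl⟩ := List.getElem?_eq_some_iff.1 hb
      obtain ⟨q, hq, hu⟩ := (h.trees.get hd (hlen ▸ hd)).root
      exact ⟨q, StoreTree.graft_cons_eq_some.2 ⟨_, by simp [hlen ▸ hd], hq⟩, hu⟩
    · obtain ⟨F, hF, hw⟩ := StoreTree.graft_cons_eq_some.1 hp'
      obtain ⟨_, _, hu⟩ := htree hF
      obtain ⟨q, hq, hu⟩ := hu.child hw hb
      exact ⟨q, StoreTree.graft_cons_eq_some.2 ⟨F, hF, hq⟩, hu⟩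
  · rintro (_ | ⟨e, w⟩) p' hp' d hd
    · obtain rfl : p = p' := by simpa [StoreTree.graft] using hp'
      have : Fs[d.val]? = none := by
        rw [List.getElem?_eq_none_iff] at hd ⊢
        omega
      simp [StoreTree.graft, this]
    · obtain ⟨F, hF, hw⟩ := StoreTree.graft_cons_eq_some.1 hp'
      obtain ⟨_, _, hu⟩ := htree hF
      simp [StoreTree.graft, hF, hu.leaf hw hd]
  · rintro (_ | ⟨e, w⟩) d p' hp'
    · exact ⟨p, rfl⟩
    · obtain ⟨F, hF, hw⟩ := StoreTree.graft_cons_eq_some.1 hp'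
      obtain ⟨_, _, hu⟩ := htree hF
      obtain ⟨q, hq⟩ := hu.parent hw
      exact ⟨q, StoreTree.graft_cons_eq_some.2 ⟨F, hF, hq⟩⟩
  · have hfin : (⋃ d : Fin κ, ⋃ F ∈ {F | Fs[d.val]? = some F},
        (List.cons d) '' {w | F.1 w ≠ none}).Finite := by
      refine Set.finite_iUnion fun d => Set.Finite.biUnion ?_ fun F hF => ?_
      · exact Set.Subsingleton.finite fun F hF G hG => Option.some.inj (hF.symm.trans hG)
      · obtain ⟨_, _, hu⟩ := htree hF
        exact hu.finite.image _
    refine (hfin.insert []).subset ?_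
    rintro (_ | ⟨d, w⟩) hw
    · exact Set.mem_insert _ _
    · obtain ⟨p', hp'⟩ := Option.ne_none_iff_exists'.1 hw
      obtain ⟨F, hF, hw⟩ := StoreTree.graft_cons_eq_some.1 hp'
      refine Or.inr (Set.mem_iUnion.2 ⟨d, Set.mem_biUnion hF ⟨w, ?_, rfl⟩⟩)
      simp [hw]
  · rw [StoreTree.exists_graft hlκ, h.comp]
    refine or_congr_right (exists_congr fun F => and_congr_right fun hF => ?_)
    obtain ⟨d, hd⟩ := List.getElem?_of_mem hF
    obtain ⟨_, _, hu⟩ := htree hd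
    exact hu.comp C x
  · rw [StoreTree.exists_graft hlκ, h.inter]
    refine or_congr_right (exists_congr fun F => and_congr_right fun hF => ?_)
    obtain ⟨d, hd⟩ := List.getElem?_of_mem hF
    obtain ⟨_, _, hu⟩ := htree hd
    exact hu.inter I x
  · rw [StoreTree.exists_graft hlκ, h.mark]
    refine or_congr_right (exists_congr fun F => and_congr_right fun hF => ?_)
    obtain ⟨d, hd⟩ := List.getElem?_of_mem hF
    obtain ⟨_, _, hu⟩ := htree hd
    exact hu.mark q x
  · -- The root and a node of a subtree do not describe the same component.
    have key : ∀ {a d w p' a'}, a ∈ (Δ.rule p.1).body.stateAtoms →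
        StoreTree.graft p Fs (d :: w) = some p' → a' ∈ (Δ.rule p'.1).body.stateAtoms →
        β.comp a.1 = β.comp a'.1 → p.2 a.2 = p'.2 a'.2 → False := by
      intro a d w p' a' ha hw ha' hc hx
      obtain ⟨F, hF, hw⟩ := StoreTree.graft_cons_eq_some.1 hw
      obtain ⟨_, _, hu⟩ := htree hF
      exact h.fresh a ha F (List.mem_of_getElem? hF)
        ((hu.comp _ _).2 ⟨w, p', hw, a', ha', hc.symm, hx.symm⟩)
    rintro (_ | ⟨d, w⟩) p₁ a₁ (_ | ⟨e, v⟩) p₂ a₂ h₁ ha₁ h₂ ha₂ hc hx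
    · rfl
    · obtain rfl : p = p₁ := by simpa [StoreTree.graft] using h₁
      exact (key ha₁ h₂ ha₂ hc hx).elim
    · obtain rfl : p = p₂ := by simpa [StoreTree.graft] using h₂
      exact (key ha₂ h₁ ha₁ hc.symm hx.symm).elim
    · obtain ⟨F, hF, hw⟩ := StoreTree.graft_cons_eq_some.1 h₁
      obtain ⟨G, hG, hv⟩ := StoreTree.graft_cons_eq_some.1 h₂
      obtain ⟨_, _, hu⟩ := htree hF
      obtain ⟨_, _, hu'⟩ := htree hG
      have hxF := (hu.comp _ _).2 ⟨w, p₁, hw, a₁, ha₁, rfl, rfl⟩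
      have hxG := (hu'.comp _ _).2 ⟨v, p₂, hv, a₂, ha₂, hc.symm, hx.symm⟩
      have hdisj : ∀ {i j : ℕ} {F G}, i < j → Fs[i]? = some F → Fs[j]? = some G →
          ∀ C, Disjoint (F.2.arch.comp C) (G.2.arch.comp C) := by
        intro i j F G hij hF hG
        obtain ⟨hi, rfl⟩ := List.getElem?_eq_some_iff.1 hF
        obtain ⟨hj, rfl⟩ := List.getElem?_eq_some_iff.1 hG
        exact List.pairwise_iff_getElem.1 h.disj i j hi hj hij
      rcases lt_trichotomy d e with hde | rfl | hde
      · exact (Set.disjoint_left.1 (hdisj hde hF hG _) hxF hxG).elim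
      · obtain rfl : F = G := Option.some.inj (hF.symm.trans hG)
        rw [hu.inj hw ha₁ hv ha₂ hc hx]
      · exact (Set.disjoint_left.1 (hdisj hde hG hF _) hxG hxF).elim

/-- A derivation of the satisfaction of a prenex formula yields unfoldings of the predicate atoms
of its matrix, under a store that also interprets the quantified variables. Every subformula met in
a derivation is prenex, with no quantified variable inside a matrix, so the statement is proved by
induction on the derivation. -/
lemma Sat.exists_isForest (hΔ : Δ.IsStandard) (hκ : ∀ i, (Δ.rule i).body.npred ≤ κ)
    {c : Config β U} {s : ℕ → U} {ψ : CL β} (h : Sat Δ c s ψ) :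
    ∀ {ys M}, ψ.IsPrenex ys M → ∃ s' : ℕ → U, (∀ v ∉ ys, s' v = s v) ∧
      ∃ Fs : List (StoreTree κ Δ U × Config β U), IsForest Fs c s' M := by
  induction h with
  | emp c s hC hI hm =>
    rintro (_ | ⟨y, ys⟩) M ⟨h1, h2, h3⟩
    · obtain rfl : _ = M := h1
      exact ⟨s, fun _ _ => rfl, [], by
        constructor <;> simp [CL.predAtoms, CL.stateAtoms, CL.interAtoms, hC, hI, hm]⟩
    · cases h1
  | comp c s C x q hq hC hC' hI hm =>
    rintro (_ | ⟨y, ys⟩) M ⟨h1, h2, h3⟩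
    · obtain rfl : _ = M := h1
      simp [CL.plainAtoms] at h3
    · cases h1
  | compAt c s q x hC hC' hI hm =>
    rintro (_ | ⟨y, ys⟩) M ⟨h1, h2, h3⟩
    · obtain rfl : _ = M := h1
      refine ⟨s, fun _ _ => rfl, [], by simp [CL.predAtoms], fun C y => ?_, ?_, ?_, by simp,
        by simp⟩
      · by_cases h : C = β.comp q
        · subst h; simp [hC, CL.stateAtoms, eq_comm]
        · simp [hC' C h, CL.stateAtoms, Ne.symm h]
      · simp [CL.interAtoms, hI]
      · simp [hm, CL.stateAtoms, eq_comm]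
    · cases h1
  | inter c s I x hC hI hI' hm =>
    rintro (_ | ⟨y, ys⟩) M ⟨h1, h2, h3⟩
    · obtain rfl : _ = M := h1
      refine ⟨s, fun _ _ => rfl, [], by simp [CL.predAtoms], ?_, fun J y => ?_, ?_, by simp,
        by simp⟩
      · simp [CL.stateAtoms, hC]
      · by_cases h : J = I
        · subst h; simp [hI, CL.interAtoms, eq_comm]
        · simp [hI' J h, CL.interAtoms, h]
      · simp [hm, CL.stateAtoms]
    · cases h1
  | pred c s s' A x i hA hs h ih =>
    rintro (_ | ⟨y, ys⟩) M ⟨h1, h2, h3⟩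
    · obtain rfl : _ = M := h1
      obtain ⟨zs, N, hN⟩ := hΔ.exists_isPrenex i
      obtain ⟨s'', hs'', Fs, hF⟩ := ih hN
      have hF' : IsForest Fs c s'' (Δ.rule i).body := by
        obtain ⟨h1, h2, h3, h4, h5, h6⟩ := hF
        constructor <;>
          simpa only [hN.1, CL.stateAtoms_exs, CL.interAtoms_exs, CL.predAtoms_exs]
      have hu : Unfolds Δ A (fun j => s (x j)) (i, s'') := by
        refine ⟨hA, fun j => ?_⟩
        change s'' _ = s (x j)
        rw [← hs j]
        refine hs'' _ (CL.notMem_of_mem_fv_exs (M := N) ?_)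
        rw [← hN.1, (Δ.rule i).fv_body]
        simp
      have hg := IsForest.isUnfolding_graft hκ hu hF'
      refine ⟨s, fun _ _ => rfl, [(StoreTree.graft (i, s'') Fs, c)], ?_⟩
      constructor <;> simp [CL.predAtoms, CL.stateAtoms, CL.interAtoms, hg]
    · cases h1
  | star c c₁ c₂ s φ ψ hc h₁ h₂ ih₁ ih₂ =>
    rintro (_ | ⟨y, ys⟩) M ⟨h1, h2, h3⟩
    · obtain rfl : _ = M := h1
      simp only [CL.plainAtoms, List.append_eq_nil_iff] at h3
      obtain ⟨s₁, hs₁, Fs, hF⟩ := ih₁ (ys := []) ⟨rfl, h2.1, h3.1⟩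
      obtain ⟨s₂, hs₂, Gs, hG⟩ := ih₂ (ys := []) ⟨rfl, h2.2, h3.2⟩
      obtain rfl : s₁ = s := funext fun v => hs₁ v (by simp)
      obtain rfl : s₂ = s₁ := funext fun v => hs₂ v (by simp)
      exact ⟨s₂, fun _ _ => rfl, _, hF.star Δ hc hG⟩
    · cases h1
  | ex c s x u φ h ih =>
    rintro (_ | ⟨y, ys⟩) M ⟨h1, h2, h3⟩
    · obtain rfl : _ = M := h1
      cases h2
    · simp only [CL.exs_cons, CL.ex.injEq] at h1
      obtain ⟨rfl, h1⟩ := h1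
      obtain ⟨s', hs', hF⟩ := ih ⟨h1, h2, h3⟩
      refine ⟨s', fun v hv => ?_, hF⟩
      simp only [List.mem_cons, not_or] at hv
      rw [hs' v hv.2, Function.update_of_ne hv.1]

/-- Every model of a sentence `φ` that is the body of the rule `r` is described by a rewriting tree
whose root is labeled by `r`. -/
lemma Models.exists_isUnfolding (hΔ : Δ.IsStandard) (hκ : ∀ i, (Δ.rule i).body.npred ≤ κ)
    {c : Config β U} {φ : CL β} {r : Fin Δ.size} (hr : Δ.IsSentenceRule r φ)
    (h : Models Δ c φ) : ∃ (T : StoreTree κ Δ U) (u : _), T.IsUnfolding c (Δ.rule r).head u ∧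
      ∃ s, T [] = some (r, s) := by
  obtain ⟨s, h⟩ := h
  obtain ⟨ys, M, hM⟩ := hΔ.exists_isPrenex r
  obtain ⟨s', -, Fs, hF⟩ := h.exists_isForest hΔ hκ (hr.2.1 ▸ hM)
  have hF' : IsForest Fs c s' (Δ.rule r).body := by
    obtain ⟨h1, h2, h3, h4, h5, h6⟩ := hF
    constructor <;>
      simpa only [hM.1, CL.stateAtoms_exs, CL.interAtoms_exs, CL.predAtoms_exs]
  exact ⟨_, fun j => s' ((Δ.rule r).params j),
    IsForest.isUnfolding_graft (p := (r, s')) hκ ⟨rfl, fun j => rfl⟩ hF', s', rfl⟩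

end Trees

/-! ### Precise markings -/

section Precise

variable {S : Signature} {β : Behavior S} {U : Type*}

/-- The marking `m` has exactly one state for each component of `α`, and no other places. -/
structure Architecture.IsPrecise (α : Architecture S U) (m : Set (Place β U)) : Prop where
  mem : ∀ {q x}, (q, x) ∈ m → x ∈ α.comp (β.comp q)
  exists_state : ∀ {C x}, x ∈ α.comp C → ∃ q, β.comp q = C ∧ (q, x) ∈ m
  unique : ∀ {q q' x}, (q, x) ∈ m → (q', x) ∈ m → β.comp q = β.comp q' → q = q'

lemma Architecture.IsPrecise.fires {α : Architecture S U} {m m' : Set (Place β U)}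
    (hm : α.IsPrecise m) {t : NetTransition β U} (ht : t ∈ (systemNet α β).transitions)
    (h : (systemNet α β).Fires t m m') : α.IsPrecise m' := by
  obtain ⟨-, hsync, hne⟩ := ht
  obtain ⟨hen, rfl⟩ := h
  have hpre : ∀ i, (t.src i, t.idx i) ∈ m := fun i => hen ⟨i, rfl⟩
  have hsrc : ∀ i, β.comp (t.src i) = S.compOf (S.iports t.inter i) :=
    fun i => (β.step_comp (hsync i)).1
  have hdst : ∀ i, β.comp (t.dst i) = S.compOf (S.iports t.inter i) :=
    fun i => (β.step_comp (hsync i)).2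
  -- A place that stays marked belongs to a component that does not take part in `t`.
  have hstay : ∀ {q x i}, (q, x) ∈ m \ (systemNet α β).pre t → x = t.idx i →
      β.comp q ≠ β.comp (t.dst i) := by
    rintro q x i ⟨hq, hn⟩ rfl hc
    have := hm.unique hq (hpre i) (hc.trans ((hdst i).trans (hsrc i).symm))
    exact hn ⟨i, by rw [this]⟩
  refine ⟨?_, ?_, ?_⟩
  · rintro q x (⟨hq, -⟩ | ⟨i, hi⟩)
    · exact hm.mem hq
    · obtain ⟨rfl, rfl⟩ := Prod.mk.inj hi
      have := hm.mem (hpre i)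
      rwa [hdst, ← hsrc]
  · intro C x hx
    obtain ⟨q, rfl, hq⟩ := hm.exists_state hx
    by_cases h : (q, x) ∈ (systemNet α β).pre t
    · obtain ⟨i, hi⟩ := h
      obtain ⟨rfl, rfl⟩ := Prod.mk.inj hi
      exact ⟨t.dst i, (hdst i).trans (hsrc i).symm, Or.inr ⟨i, rfl⟩⟩
    · exact ⟨q, rfl, Or.inl ⟨hq, h⟩⟩
  · rintro q q' x (h | ⟨i, hi⟩) (h' | ⟨j, hj⟩) hc
    · exact hm.unique h.1 h'.1 hc
    · obtain ⟨rfl, rfl⟩ := Prod.mk.inj hj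
      exact (hstay h rfl hc).elim
    · obtain ⟨rfl, rfl⟩ := Prod.mk.inj hi
      exact (hstay h' rfl hc.symm).elim
    · -- Both places are produced by `t`; its ports act on distinct components.
      obtain ⟨rfl, rfl⟩ := Prod.mk.inj hi
      obtain ⟨rfl, hx⟩ := Prod.mk.inj hj
      by_cases hij : i = j
      · rw [hij]
      · rcases hne i j hij with h | h
        · exact (h hx).elim
        · rw [hdst, hdst] at hc
          exact (h hc).elim

lemma Architecture.IsPrecise.reach {α : Architecture S U} {m m' : Set (Place β U)}
    (hm : α.IsPrecise m) (h : m' ∈ (systemNet α β).reach m) : α.IsPrecise m' := by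
  change Relation.ReflTransGen _ m m' at h
  induction h with
  | refl => exact hm
  | tail _ h ih => obtain ⟨t, ht, h⟩ := h; exact ih.fires ht h

end Precise

/-! ### Places of the net as nodes of the rewriting tree -/

namespace StoreTree

variable {S : Signature} {β : Behavior S} {U : Type*} {κ : ℕ} {Δ : SID β}

/-- The component `C[x]` is described by the state atom at the node `w`. -/
def Hosts (T : StoreTree κ Δ U) (w : Node κ) (C : S.Comp) (x : U) : Prop :=
  ∃ p, T w = some p ∧ ∃ a ∈ (Δ.rule p.1).body.stateAtoms, β.comp a.1 = C ∧ p.2 a.2 = x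

lemma Hosts.unique (hΔ : Δ.IsStandard) {T : StoreTree κ Δ U} {w : Node κ} {C C' : S.Comp}
    {x x' : U} (h : T.Hosts w C x) (h' : T.Hosts w C' x') : C = C' ∧ x = x' := by
  obtain ⟨p, hp, a, ha, rfl, rfl⟩ := h
  obtain ⟨p', hp', a', ha', rfl, rfl⟩ := h'
  obtain rfl : p = p' := Option.some.inj (hp.symm.trans hp')
  obtain rfl := hΔ.stateAtoms_unique ha ha'
  exact ⟨rfl, rfl⟩

/-- The set of nodes of a finite tree that are labeled by the rule `i`. -/
noncomputable def rules {T : StoreTree κ Δ U} (hT : {w | T w ≠ none}.Finite) (i : Fin Δ.size) :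
    Finset (Node κ) :=
  hT.toFinset.filter fun w => ∃ s, T w = some (i, s)

lemma mem_rules {T : StoreTree κ Δ U} {hT : {w | T w ≠ none}.Finite} {i : Fin Δ.size}
    {w : Node κ} : w ∈ rules hT i ↔ ∃ s, T w = some (i, s) := by
  simp only [rules, Finset.mem_filter, Set.Finite.mem_toFinset, Set.mem_ofPred_eq,
    and_iff_right_iff_imp]
  rintro ⟨s, h⟩
  simp [h]

/-- The tuple of sets of nodes that corresponds to a set of places: the place `q[x]` becomes the
element of the set of index `q` that hosts the component of index `x`. -/
noncomputable def image {T : StoreTree κ Δ U} (hT : {w | T w ≠ none}.Finite)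
    (m : Set (Place β U)) (q : β.State) : Finset (Node κ) :=
  hT.toFinset.filter fun w => ∃ x, T.Hosts w (β.comp q) x ∧ (q, x) ∈ m

lemma mem_image {T : StoreTree κ Δ U} {hT : {w | T w ≠ none}.Finite} {m : Set (Place β U)}
    {q : β.State} {w : Node κ} :
    w ∈ image hT m q ↔ ∃ x, T.Hosts w (β.comp q) x ∧ (q, x) ∈ m := by
  simp only [image, Finset.mem_filter, Set.Finite.mem_toFinset, Set.mem_ofPred_eq,
    and_iff_right_iff_imp]
  rintro ⟨x, ⟨p, hp, -⟩, -⟩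
  simp [hp]

namespace IsUnfolding

variable {T : StoreTree κ Δ U} {c : Config β U} {A : PredSym} {u : Fin A.arity → U}
  (hT : T.IsUnfolding c A u)

include hT

lemma hosts_inj {w w' : Node κ} {C : S.Comp} {x : U} (h : T.Hosts w C x)
    (h' : T.Hosts w' C x) : w = w' := by
  obtain ⟨p, hp, a, ha, rfl, rfl⟩ := h
  obtain ⟨p', hp', a', ha', hc, hx⟩ := h'
  exact hT.inj hp ha hp' ha' hc.symm hx.symm

lemma mem_comp {C : S.Comp} {x : U} : x ∈ c.arch.comp C ↔ ∃ w, T.Hosts w C x := hT.comp C x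

lemma isPrecise (hΔ : Δ.IsStandard) : c.arch.IsPrecise c.mark where
  mem h := by
    obtain ⟨w, p, hp, v, hv, hx⟩ := (hT.mark _ _).1 h
    exact hT.mem_comp.2 ⟨w, p, hp, _, hv, rfl, hx⟩
  exists_state h := by
    obtain ⟨w, p, hp, ⟨q, v⟩, ha, hc, hx⟩ := hT.mem_comp.1 h
    exact ⟨q, hc, (hT.mark _ _).2 ⟨w, p, hp, v, ha, hx⟩⟩
  unique h h' hc := by
    obtain ⟨w, p, hp, v, hv, rfl⟩ := (hT.mark _ _).1 h
    obtain ⟨w', p', hp', v', hv', hx⟩ := (hT.mark _ _).1 h'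
    obtain rfl := hT.inj hp hv hp' hv' hc hx.symm
    obtain rfl : p = p' := Option.some.inj (hp.symm.trans hp')
    exact (Prod.mk.inj (hΔ.stateAtoms_unique hv hv')).1

lemma isMark_image (hΔ : Δ.IsStandard) {m : Set (Place β U)} (hm : c.arch.IsPrecise m) :
    IsMark Δ (rules hT.finite) (image hT.finite m) := by
  intro w C
  refine ⟨fun q q' hqq hq hq' => ?_, ?_, ?_⟩
  · by_contra h
    push Not at h
    obtain ⟨x, hx, hxm⟩ := mem_image.1 h.1
    obtain ⟨x', hx', hxm'⟩ := mem_image.1 h.2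
    obtain ⟨hc, rfl⟩ := hx.unique hΔ hx'
    exact hqq (hm.unique hxm hxm' hc)
  · rintro ⟨q, rfl, hq⟩
    obtain ⟨x, ⟨p, hp, a, ha, hc, -⟩, -⟩ := mem_image.1 hq
    exact ⟨p.1, ⟨a, ha, hc⟩, mem_rules.2 ⟨p.2, hp⟩⟩
  · rintro ⟨j, ⟨a, ha, rfl⟩, hw⟩
    obtain ⟨s, hs⟩ := mem_rules.1 hw
    have hh : T.Hosts w (β.comp a.1) (s a.2) := ⟨_, hs, a, ha, rfl, rfl⟩
    obtain ⟨q, hq, hqm⟩ := hm.exists_state (hT.mem_comp.2 ⟨w, hh⟩)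
    exact ⟨q, hq, mem_image.2 ⟨_, hq ▸ hh, hqm⟩⟩

lemma mem_image_mark {w : Node κ} {q : β.State} : w ∈ image hT.finite c.mark q ↔
    ∃ l, (∃ v, (q, v) ∈ (Δ.rule l).body.stateAtoms) ∧ w ∈ rules hT.finite l := by
  rw [mem_image]
  constructor
  · rintro ⟨x, hx, hm⟩
    obtain ⟨w', p, hp, v, hv, hvx⟩ := (hT.mark _ _).1 hm
    obtain rfl := hT.hosts_inj hx ⟨p, hp, _, hv, rfl, hvx⟩
    exact ⟨p.1, ⟨v, hv⟩, mem_rules.2 ⟨p.2, hp⟩⟩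
  · rintro ⟨l, ⟨v, hv⟩, hw⟩
    obtain ⟨s, hs⟩ := mem_rules.1 hw
    exact ⟨s v, ⟨_, hs, _, hv, rfl, rfl⟩, (hT.mark _ _).2 ⟨w, _, hs, v, hv, rfl⟩⟩

/-- The root is the only node labeled by `r`, as the head of `r` occurs in no rule body. -/
lemma isRewrTree {r : Fin Δ.size} {φ : CL β} (hr : Δ.IsSentenceRule r φ)
    (hroot : ∃ s, T [] = some (r, s)) : IsRewrTree Δ (rules hT.finite) r where
  disj i j hij w := by
    by_contra h
    push Not at h
    obtain ⟨s, hs⟩ := mem_rules.1 h.1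
    obtain ⟨s', hs'⟩ := mem_rules.1 h.2
    rw [hs] at hs'
    simp only [Option.some.injEq, Prod.mk.injEq] at hs'
    exact hij.ne hs'.1
  root w := by
    rw [mem_rules]
    refine ⟨?_, fun h => h ▸ hroot⟩
    rintro ⟨s, hs⟩
    rcases List.eq_nil_or_concat w with rfl | ⟨w', d, rfl⟩
    · rfl
    · rw [List.concat_eq_append] at hs
      obtain ⟨p, hp⟩ := hT.parent hs
      cases hb : (Δ.rule p.1).body.predAtoms[d.val]? with
      | none => rw [hT.leaf hp hb] at hs; cases hs
      | some b =>
        obtain ⟨p', hp', hh, -⟩ := hT.child hp hb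
        obtain rfl : p' = (r, s) := Option.some.inj (hp'.symm.trans hs)
        exact (hr.2.2.2 p.1 b (List.mem_of_getElem? hb) hh).elim
  parent w d i hw := by
    obtain ⟨s, hs⟩ := mem_rules.1 hw
    obtain ⟨p, hp⟩ := hT.parent hs
    exact ⟨p.1, mem_rules.2 ⟨p.2, hp⟩⟩
  child w i hw d hd := by
    obtain ⟨s, hs⟩ := mem_rules.1 hw
    obtain ⟨p', hp', hh, -⟩ := hT.child hs (List.getElem?_eq_getElem hd)
    exact ⟨p'.1, by simp [← hh, List.getElem?_eq_getElem hd], mem_rules.2 ⟨p'.2, hp'⟩⟩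
  leaf w i hw d hd l hl := by
    obtain ⟨s, hs⟩ := mem_rules.1 hw
    obtain ⟨s', hs'⟩ := mem_rules.1 hl
    rw [hT.leaf hs (List.getElem?_eq_none hd)] at hs'
    cases hs'

/-! ### Paths in the rewriting tree -/

/-- Tightness, read along the tree: a variable to which the profile assigns the component type `C`
is passed down from rule to rule until it reaches a node that hosts a component of type `C`. The
number `n` bounds the depth of the tree below `w`. The sets `Y s` contain only descendants of `w`,
so that the run can be prolonged upwards by the parent of `w` without losing disjointness. -/
lemma exists_isRun (hκ : ∀ i, (Δ.rule i).body.npred ≤ κ) {lam : Profile S}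
    (hlam : Δ.TightFor lam) (n : ℕ) {w : Node κ} {p : Fin Δ.size × (ℕ → U)} {v : ℕ}
    {C : S.Comp} (hw : T w = some p) (hn : ∀ z, T z ≠ none → z.length < n + w.length)
    (hv : (∃ q, (q, v) ∈ (Δ.rule p.1).body.stateAtoms ∧ C = β.comp q) ∨
      ∃ b ∈ (Δ.rule p.1).body.predAtoms, ∃ l, v = b.2 l ∧ C = lam b.1 l) :
    ∃ y Y, T.Hosts y C (p.2 v) ∧ (pathAut κ Δ p.1 v).IsRun Y w y ∧
      ∀ s, ∀ z ∈ Y s, z ∈ rules hT.finite s.1 ∧ w <+: z := by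
  induction n generalizing w p v with
  | zero => simpa using hn w (by simp [hw])
  | succ n ih =>
    rcases hv with ⟨q, hq, rfl⟩ | ⟨⟨B, y⟩, hb, k, rfl, rfl⟩
    · refine ⟨w, fun s => if s = (p.1, v) then {w} else ∅, ⟨p, hw, _, hq, rfl, rfl⟩, ?_, ?_⟩
      · have key : ∀ {s : Fin Δ.size × ℕ} {z}, z ∈ (if s = (p.1, v) then {w} else ∅ :
            Finset (Node κ)) ↔ s = (p.1, v) ∧ z = w := by
          intro s z; split_ifs with h <;> simp [h]
        refine ⟨fun s _ t _ z hz hz' => ?_, ⟨(p.1, v), by simp [pathAut], by simp⟩,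
          ⟨(p.1, v), ?_, by simp⟩, fun s _ z hz hzw => (hzw (key.1 hz).2).elim,
          fun s _ z hz hzw => (hzw (key.1 hz).2).elim⟩
        · rw [(key.1 hz).1, (key.1 hz').1]
        · simp only [pathAut, Finset.mem_filter, mem_autStates]
          exact ⟨CL.mem_vars_of_mem_stateAtoms hq, q, hq⟩
      · intro s z hz
        dsimp only at hz
        split_ifs at hz with h
        · obtain rfl := Finset.mem_singleton.1 hz
          exact ⟨mem_rules.2 ⟨p.2, by rw [hw, h]⟩, List.prefix_refl _⟩
        · simp at hz
    · obtain ⟨d, hd⟩ := List.getElem?_of_mem hb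
      have hdκ : d < κ := (List.getElem?_eq_some_iff.1 hd).1.trans_le (hκ _)
      obtain ⟨⟨i, s⟩, hp', hB, hs⟩ := hT.child hw (d := ⟨d, hdκ⟩) hd
      simp only at hB hs
      subst hB
      have hsk : s ((Δ.rule i).params k) = p.2 (y k) := hs k
      obtain ⟨e, Y, hhost, hrun, hY⟩ := ih (v := (Δ.rule i).params k) hp'
        (fun z hz => by have := hn z hz; simp; omega) ((hlam i).2 k)
      simp only at hhost hrun
      have hmem₁ : ((i, (Δ.rule i).params k) : Fin Δ.size × ℕ) ∈ autStates Δ := by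
        rw [mem_autStates]
        rcases (hlam i).2 k with ⟨q, hq, -⟩ | ⟨b, hb, l, hl, -⟩
        · exact CL.mem_vars_of_mem_stateAtoms hq
        · rw [hl]; exact CL.mem_vars_of_mem_predAtoms hb l
      have hmem₀ : ((p.1, y k) : Fin Δ.size × ℕ) ∈ autStates Δ :=
        mem_autStates.2 (CL.mem_vars_of_mem_predAtoms hb k)
      have htrans : (((p.1, y k), ⟨d, hdκ⟩, (i, (Δ.rule i).params k)) :
          (Fin Δ.size × ℕ) × Fin κ × (Fin Δ.size × ℕ)) ∈ (pathAut κ Δ p.1 (y k)).trans := by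
        simp only [pathAut, Finset.mem_filter, Finset.mem_product, Finset.mem_univ, true_and]
        exact ⟨⟨hmem₀, hmem₁⟩, y, k, hd, rfl, rfl⟩
      have hinit : w ++ [⟨d, hdκ⟩] ∈ Y (i, (Δ.rule i).params k) := by
        obtain ⟨s', hs', h⟩ := hrun.init
        simp only [pathAut, Finset.mem_singleton] at hs'
        rwa [hs'] at h
      have hnot : ∀ s, w ∉ Y s := fun s h => by
        have := (hY s w h).2.length_le
        simp at this
      have key : ∀ {s : Fin Δ.size × ℕ} {z}, z ∈ Y s ∪ (if s = (p.1, y k) then {w} else ∅) ↔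
          z ∈ Y s ∨ s = (p.1, y k) ∧ z = w := by
        intro s z; split_ifs with h <;> simp [h, or_comm]
      refine ⟨e, fun s => Y s ∪ (if s = (p.1, y k) then {w} else ∅), hsk ▸ hhost,
        ⟨fun s hs t ht z hz hz' => ?_, ⟨(p.1, y k), by simp [pathAut], by simp⟩, ?_,
          fun s hs z hz hzy => ?_, fun s hs z hz hzw => ?_⟩, fun s z hz => ?_⟩
      · rcases key.1 hz with hz | ⟨rfl, rfl⟩ <;> rcases key.1 hz' with hz' | ⟨rfl, hzw⟩
        · exact hrun.disj s hs t ht z hz hz'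
        · exact (hnot _ (hzw ▸ hz)).elim
        · exact (hnot _ hz').elim
        · rfl
      · obtain ⟨s', hs', h⟩ := hrun.final
        exact ⟨s', hs', key.2 (Or.inl h)⟩
      · rcases key.1 hz with hz | ⟨rfl, rfl⟩
        · obtain ⟨t, ht, hts, h⟩ := hrun.next s hs z hz hzy
          exact ⟨t, ht, hts, key.2 (Or.inl h)⟩
        · exact ⟨_, htrans, rfl, key.2 (Or.inl hinit)⟩
      · rcases key.1 hz with hz | ⟨-, hzw'⟩
        · by_cases hz' : z = w ++ [⟨d, hdκ⟩]
          · subst hz'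
            have := hrun.disj _ hs _ hmem₁ _ hz hinit
            exact ⟨_, htrans, this.symm, w, key.2 (Or.inr ⟨rfl, rfl⟩), rfl⟩
          · obtain ⟨t, ht, hts, z', h, h'⟩ := hrun.prev s hs z hz hz'
            exact ⟨t, ht, hts, z', key.2 (Or.inl h), h'⟩
        · exact (hzw hzw').elim
      · rcases key.1 hz with hz | ⟨rfl, rfl⟩
        · exact ⟨(hY s z hz).1, (List.prefix_append _ _).trans (hY s z hz).2⟩
        · exact ⟨mem_rules.2 ⟨p.2, hw⟩, List.prefix_refl _⟩

/-- Each argument of an interaction atom at `w` is connected by a path to the node that hosts the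
component taking part in the interaction through the corresponding port. -/
lemma exists_isPath (hκ : ∀ i, (Δ.rule i).body.npred ≤ κ) {lam : Profile S}
    (hlam : Δ.TightFor lam) {w : Node κ} {p : Fin Δ.size × (ℕ → U)} (hw : T w = some p) {a}
    (ha : a ∈ (Δ.rule p.1).body.interAtoms) (k : Fin (S.arity a.1)) :
    ∃ y, T.Hosts y (S.compOf (S.iports a.1 k)) (p.2 (a.2 k)) ∧
      IsPath Δ (rules hT.finite) p.1 (a.2 k) w y := by
  obtain ⟨n, hn⟩ : ∃ n, ∀ z, T z ≠ none → z.length < n := by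
    obtain ⟨n, hn⟩ := (hT.finite.image List.length).bddAbove
    exact ⟨n + 1, fun z hz => Nat.lt_succ_of_le (hn ⟨z, hz, rfl⟩)⟩
  obtain ⟨y, Y, hy, hrun, hY⟩ := hT.exists_isRun hκ hlam n (v := a.2 k) hw
    (fun z hz => Nat.lt_add_right _ (hn z hz)) ((hlam p.1).1 a ha k)
  exact ⟨y, hy, Y, hrun, fun s _ z hz => (hY s z hz).1⟩

/-- Along a path the value of the tracked variable does not change. The sets `Y s` may contain nodes
off the path, hence the path is recovered from its end: each node other than `x` has a predecessor,
which is its parent, and the root has none. -/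
lemma hosts_of_isPath {l : Fin Δ.size} {v : ℕ} {x y : Node κ} {s : ℕ → U}
    (hv : (l, v) ∈ autStates Δ) (h : IsPath Δ (rules hT.finite) l v x y)
    (hx : T x = some (l, s)) : ∃ C, T.Hosts y C (s v) := by
  obtain ⟨Y, hrun, hY⟩ := h
  have key : ∀ z : Node κ, ∀ t ∈ autStates Δ, z ∈ Y t → ∀ p, T z = some p →
      p.2 t.2 = s v := by
    intro z
    induction z using List.reverseRecOn with
    | nil =>
      intro t ht hz p hp
      by_cases hzx : [] = x
      · subst hzx
        obtain ⟨i, hi, hxi⟩ := hrun.init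
        obtain rfl : i = (l, v) := by simpa [pathAut] using hi
        obtain rfl := hrun.disj _ ht _ hv _ hz hxi
        obtain rfl : p = (l, s) := Option.some.inj (hp.symm.trans hx)
        rfl
      · obtain ⟨_, -, -, z', -, hz'⟩ := hrun.prev t ht _ hz hzx
        simp at hz'
    | append_singleton z d ih =>
      intro t ht hz p hp
      by_cases hzx : z ++ [d] = x
      · subst hzx
        obtain ⟨i, hi, hxi⟩ := hrun.init
        obtain rfl : i = (l, v) := by simpa [pathAut] using hi
        obtain rfl := hrun.disj _ ht _ hv _ hz hxi
        obtain rfl : p = (l, s) := Option.some.inj (hp.symm.trans hx)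
        rfl
      · obtain ⟨⟨t', e, _⟩, htr, rfl, z', hz', hzz⟩ := hrun.prev t ht _ hz hzx
        simp only at *
        obtain ⟨rfl, hed⟩ := List.append_inj' hzz rfl
        obtain rfl : e = d := by simpa using hed
        simp only [pathAut, Finset.mem_filter, Finset.mem_product, Finset.mem_univ,
          true_and] at htr
        obtain ⟨⟨ht', -⟩, b, j, hb, hbj, hj⟩ := htr
        obtain ⟨s', hs'⟩ := mem_rules.1 (hY _ ht' _ hz')
        obtain ⟨s'', hs''⟩ := mem_rules.1 (hY _ ht _ hz)
        obtain rfl := Option.some.inj (hp.symm.trans hs'')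
        obtain ⟨p', hp', hh, hval⟩ := hT.child hs' hb
        obtain rfl := Option.some.inj (hp'.symm.trans hs'')
        have h1 := ih _ ht' hz' _ hs'
        have h2 := hval j
        rw [← hj, ← h1, ← hbj]
        exact h2
  obtain ⟨t, ht, hy⟩ := hrun.final
  simp only [pathAut, Finset.mem_filter] at ht
  obtain ⟨ht, q, hq⟩ := ht
  obtain ⟨s', hs'⟩ := mem_rules.1 (hY _ ht _ hy)
  exact ⟨_, _, hs', _, hq, rfl, key y t ht hy _ hs'⟩

/-! ### Flows and transitions -/

/-- Every transition of the net is described by the flow formula. -/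
lemma isFlow (hΔ : Δ.IsStandard) (hκ : ∀ i, (Δ.rule i).body.npred ≤ κ) {lam : Profile S}
    (hlam : Δ.TightFor lam) {t : NetTransition β U}
    (ht : t ∈ (systemNet c.arch β).transitions) :
    IsFlow Δ (rules hT.finite) (image hT.finite ((systemNet c.arch β).pre t))
      (image hT.finite ((systemNet c.arch β).post t)) := by
  obtain ⟨I, x, src, dst⟩ := t
  obtain ⟨hI, hsync, hne⟩ := ht
  simp only at hI hsync hne
  obtain ⟨w, p, hw, a, ha, rfl⟩ := (hT.inter _ _).1 hI
  choose y hhost hpath using hT.exists_isPath hκ hlam hw ha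
  refine ⟨p.1, ⟨I, a⟩, ha, w, y, mem_rules.2 ⟨_, hw⟩, hpath, ⟨src, dst, hsync,
    fun q z => ⟨?_, ?_⟩⟩, fun i j hij => ?_⟩
  · rw [mem_image]
    constructor
    · rintro ⟨x, hx, i, hi⟩
      obtain ⟨rfl, rfl⟩ := Prod.mk.inj hi
      rw [(β.step_comp (hsync i)).1] at hx
      exact ⟨i, rfl, hT.hosts_inj hx (hhost i)⟩
    · rintro ⟨i, rfl, rfl⟩
      exact ⟨_, (β.step_comp (hsync i)).1 ▸ hhost i, i, rfl⟩
  · rw [mem_image]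
    constructor
    · rintro ⟨x, hx, i, hi⟩
      obtain ⟨rfl, rfl⟩ := Prod.mk.inj hi
      rw [(β.step_comp (hsync i)).2] at hx
      exact ⟨i, rfl, hT.hosts_inj hx (hhost i)⟩
    · rintro ⟨i, rfl, rfl⟩
      exact ⟨_, (β.step_comp (hsync i)).2 ▸ hhost i, i, rfl⟩
  · rw [or_iff_not_imp_right, not_not]
    intro hc hy
    refine (hne i j hij.ne).elim (fun h => h ?_) (fun h => h hc)
    have hi := hhost i
    rw [hc, hy] at hi
    exact (hi.unique hΔ (hhost j)).2

/-- A flow whose pre-set is contained in a marking comes from a transition enabled in it. The flow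
formula also admits tuples of nodes that host components of types other than those required by
the ports; these flows are excluded by the inclusion in the marking. -/
lemma exists_enabled (hΔ : Δ.IsStandard) {m : Set (Place β U)}
    {Y Y' : β.State → Finset (Node κ)} (h : IsFlow Δ (rules hT.finite) Y Y')
    (hY : ∀ q, Y q ⊆ image hT.finite m q) :
    ∃ t ∈ (systemNet c.arch β).transitions, (systemNet c.arch β).Enabled t m := by
  obtain ⟨l, ⟨I, a⟩, ha, w, y, hw, hpath, ⟨src, dst, hsync, hpp⟩, hne⟩ := h
  obtain ⟨s, hs⟩ := mem_rules.1 hw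
  have key : ∀ i, T.Hosts (y i) (S.compOf (S.iports I i)) (s (a i)) ∧
      (src i, s (a i)) ∈ m := by
    intro i
    obtain ⟨x, hx, hm⟩ := mem_image.1 (hY _ (((hpp (src i) (y i)).1).2 ⟨i, rfl, rfl⟩))
    obtain ⟨C, hC⟩ := hT.hosts_of_isPath
      (mem_autStates.2 (CL.mem_vars_of_mem_interAtoms ha i)) (hpath i) hs
    obtain ⟨-, rfl⟩ := hx.unique hΔ hC
    exact ⟨(β.step_comp (hsync i)).1 ▸ hx, hm⟩
  have hne' : ∀ i j, i < j → s (a i) ≠ s (a j) ∨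
      S.compOf (S.iports I i) ≠ S.compOf (S.iports I j) := by
    intro i j hij
    rw [or_iff_not_imp_right, not_not]
    intro hc hx
    refine (hne i j hij).elim (fun h => h ?_) (fun h => h hc)
    have hi := (key i).1
    rw [hc, hx] at hi
    exact hT.hosts_inj hi (key j).1
  refine ⟨⟨I, fun k => s (a k), src, dst⟩, ⟨?_, hsync, fun i j hij => ?_⟩, ?_⟩
  · exact (hT.inter _ _).2 ⟨w, _, hs, a, ha, rfl⟩
  · rcases hij.lt_or_gt with h | h
    · exact hne' i j h
    · exact (hne' j i h).imp Ne.symm Ne.symm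
  · rintro _ ⟨i, rfl⟩
    exact (key i).2

/-! ### Trap and mutex invariants -/

lemma trap_fires (hΔ : Δ.IsStandard) (hκ : ∀ i, (Δ.rule i).body.npred ≤ κ) {lam : Profile S}
    (hlam : Δ.TightFor lam) {t : NetTransition β U}
    (ht : t ∈ (systemNet c.arch β).transitions) {m m' : Set (Place β U)}
    (h : (systemNet c.arch β).Fires t m m') {Z : β.State → Finset (Node κ)}
    (hZ : IsTrap Δ (rules hT.finite) Z) (hmZ : (isect (image hT.finite m) Z).Nonempty) :
    (isect (image hT.finite m') Z).Nonempty := by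
  obtain ⟨-, rfl⟩ := h
  obtain ⟨w, hw⟩ := hmZ
  obtain ⟨q, hq, hqZ⟩ := mem_isect.1 hw
  obtain ⟨x, hx, hxm⟩ := mem_image.1 hq
  by_cases hpre : (q, x) ∈ (systemNet c.arch β).pre t
  · obtain ⟨w', hw'⟩ := hZ _ _ (hT.isFlow hΔ hκ hlam ht)
      ⟨w, mem_isect.2 ⟨q, hqZ, mem_image.2 ⟨x, hx, hpre⟩⟩⟩
    obtain ⟨q', hqZ', hq'⟩ := mem_isect.1 hw'
    obtain ⟨x', hx', hxm'⟩ := mem_image.1 hq'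
    exact ⟨w', mem_isect.2 ⟨q', mem_image.2 ⟨x', hx', Or.inr hxm'⟩, hqZ'⟩⟩
  · exact ⟨w, mem_isect.2 ⟨q, mem_image.2 ⟨x, hx, Or.inl ⟨hxm, hpre⟩⟩, hqZ⟩⟩

/-- Since `Z` meets the marking in a single node, it meets the pre-set of `t` in that node or not at
all; in the first case the firing moves it to the only node that `Z` shares with the post-set. -/
lemma mutex_fires (hΔ : Δ.IsStandard) (hκ : ∀ i, (Δ.rule i).body.npred ≤ κ) {lam : Profile S}
    (hlam : Δ.TightFor lam) {t : NetTransition β U}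
    (ht : t ∈ (systemNet c.arch β).transitions) {m m' : Set (Place β U)}
    (hm : c.arch.IsPrecise m)
    (h : (systemNet c.arch β).Fires t m m') {Z : β.State → Finset (Node κ)}
    (hZ : IsMutex Δ (rules hT.finite) Z) (hmZ : (isect (image hT.finite m) Z).card = 1) :
    (isect (image hT.finite m') Z).card = 1 := by
  obtain ⟨hen, rfl⟩ := h
  obtain ⟨h0, h1⟩ := hZ _ _ (hT.isFlow hΔ hκ hlam ht)
  obtain ⟨w, hw⟩ := Finset.card_eq_one.1 hmZ
  have hsub : isect Z (image hT.finite ((systemNet c.arch β).pre t)) ⊆ {w} := by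
    rw [← hw]
    intro z hz
    obtain ⟨q, hqZ, hq⟩ := mem_isect.1 hz
    obtain ⟨x, hx, hxp⟩ := mem_image.1 hq
    exact mem_isect.2 ⟨q, mem_image.2 ⟨x, hx, hen hxp⟩, hqZ⟩
  rcases Finset.subset_singleton_iff.1 hsub with hpre | hpre
  · rw [← hmZ]
    congr 1
    ext z
    simp only [mem_isect, mem_image]
    constructor
    · rintro ⟨q, ⟨x, hx, ⟨hxm, -⟩ | hpost⟩, hqZ⟩
      · exact ⟨q, ⟨x, hx, hxm⟩, hqZ⟩
      · have : z ∈ isect Z (image hT.finite ((systemNet c.arch β).post t)) :=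
          mem_isect.2 ⟨q, hqZ, mem_image.2 ⟨x, hx, hpost⟩⟩
        simp [h0.1 hpre] at this
    · rintro ⟨q, ⟨x, hx, hxm⟩, hqZ⟩
      refine ⟨q, ⟨x, hx, Or.inl ⟨hxm, fun hp => ?_⟩⟩, hqZ⟩
      have : z ∈ isect Z (image hT.finite ((systemNet c.arch β).pre t)) :=
        mem_isect.2 ⟨q, hqZ, mem_image.2 ⟨x, hx, hp⟩⟩
      simp [hpre] at this
  · rw [← h1.1 (by simp [hpre])]
    congr 1
    ext z
    simp only [mem_isect, mem_image]
    constructor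
    · rintro ⟨q, ⟨x, hx, ⟨hxm, hnp⟩ | hpost⟩, hqZ⟩
      · -- The node `z` is `w`, which already hosts a place of the pre-set of `t`.
        exfalso
        have hz : z ∈ isect (image hT.finite m) Z :=
          mem_isect.2 ⟨q, mem_image.2 ⟨x, hx, hxm⟩, hqZ⟩
        rw [hw, ← hpre] at hz
        obtain ⟨q', hqZ', hq'⟩ := mem_isect.1 hz
        obtain ⟨x', hx', hxp'⟩ := mem_image.1 hq'
        obtain ⟨hc, rfl⟩ := hx.unique hΔ hx'
        obtain rfl := hm.unique hxm (hen hxp') hc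
        exact hnp hxp'
      · exact ⟨q, hqZ, x, hx, hpost⟩
    · rintro ⟨q, hqZ, x, hx, hpost⟩
      exact ⟨q, ⟨x, hx, Or.inr hpost⟩, hqZ⟩

lemma trap_reach (hΔ : Δ.IsStandard) (hκ : ∀ i, (Δ.rule i).body.npred ≤ κ) {lam : Profile S}
    (hlam : Δ.TightFor lam) {m m' : Set (Place β U)} (h : m' ∈ (systemNet c.arch β).reach m)
    {Z : β.State → Finset (Node κ)} (hZ : IsTrap Δ (rules hT.finite) Z)
    (hmZ : (isect (image hT.finite m) Z).Nonempty) :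
    (isect (image hT.finite m') Z).Nonempty := by
  change Relation.ReflTransGen _ m m' at h
  induction h with
  | refl => exact hmZ
  | tail _ h ih => obtain ⟨t, ht, h⟩ := h; exact hT.trap_fires hΔ hκ hlam ht h hZ ih

lemma mutex_reach (hΔ : Δ.IsStandard) (hκ : ∀ i, (Δ.rule i).body.npred ≤ κ)
    {lam : Profile S} (hlam : Δ.TightFor lam) {m m' : Set (Place β U)}
    (hm : c.arch.IsPrecise m) (h : m' ∈ (systemNet c.arch β).reach m)
    {Z : β.State → Finset (Node κ)} (hZ : IsMutex Δ (rules hT.finite) Z)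
    (hmZ : (isect (image hT.finite m) Z).card = 1) :
    (isect (image hT.finite m') Z).card = 1 := by
  change Relation.ReflTransGen _ m m' at h
  induction h with
  | refl => exact hmZ
  | tail h' h ih =>
    obtain ⟨t, ht, h⟩ := h
    exact hT.mutex_fires hΔ hκ hlam ht (hm.reach h') h hZ ih

lemma card_le_card_image {m : Set (Place β U)} (hΔ : Δ.IsStandard) (hm : c.arch.IsPrecise m)
    {n : ℕ} {q : Fin n → β.State} {x : Fin n → U} (hx : ∀ i, (q i, x i) ∈ m)
    (hne : ∀ i j, i ≠ j → (q i, x i) ≠ (q j, x j)) (p : β.State) :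
    (Finset.univ.filter fun i => q i = p).card ≤ (image hT.finite m p).card := by
  choose w hw using fun i => hT.mem_comp.1 (hm.mem (hx i))
  refine Finset.card_le_card_of_injOn w (fun i hi => ?_) (fun i hi j hj hij => ?_)
  · obtain rfl : q i = p := by simpa using hi
    exact mem_image.2 ⟨x i, hw i, hx i⟩
  · have hi : q i = p := by simpa using hi
    have hj : q j = p := by simpa using hj
    by_contra h
    have h1 := hw i
    rw [hij] at h1
    exact hne i j h (Prod.ext (hi.trans hj.symm) (h1.unique hΔ (hw j)).2)

end IsUnfolding

end StoreTree

/-! ### Soundness of the verification conditions -/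

section Soundness

variable {S : Signature} {β : Behavior S} {U : Type*} {κ : ℕ} {Δ : SID β}

/-- The store that interprets `R_i`, `X_q` and `Y_q` by the given sets of nodes. -/
def storeOf (R : Fin Δ.size → Finset (Node κ)) (X Y : β.State → Finset (Node κ)) :
    WStore κ FOVar (SOVar Δ.size β.State) where
  fo _ := []
  so W := match W with
    | .R i => R i
    | .mk .X q => X q
    | .mk .Y q => Y q
    | _ => ∅

/-- A marking reachable in a model of `φ` satisfies the part that the two verification conditions
share. -/
lemma exists_store (hΔ : Δ.IsStandard) (hκ : ∀ i, (Δ.rule i).body.npred ≤ κ) {φ : CL β}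
    {r : Fin Δ.size} (hr : Δ.IsSentenceRule r φ) (htight : φ.IsTight Δ) {c : Config β U}
    (hc : Models Δ c φ) {m : Set (Place β U)} (hm : m ∈ (systemNet c.arch β).reach c.mark) :
    ∃ ν : WStore κ FOVar (SOVar Δ.size β.State),
      (trapInv κ Δ).Holds ν ∧ (mutexInv κ Δ).Holds ν ∧ (initForm κ Δ .Y).Holds ν ∧
      (rewrTree κ Δ r).Holds ν ∧
      (m ∈ (systemNet c.arch β).dead → (deadLock κ Δ).Holds ν) ∧
      ∀ (n : ℕ) (q : Fin n → β.State) (x : Fin n → U), (∀ i, (q i, x i) ∈ m) →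
        (∀ i j, i ≠ j → (q i, x i) ≠ (q j, x j)) → (errSet κ Δ q).Holds ν := by
  obtain ⟨lam, hlam, -⟩ := htight
  obtain ⟨T, u, hT, hroot⟩ := hc.exists_isUnfolding hΔ hκ hr
  have hc' := hT.isPrecise hΔ
  have hm' := hc'.reach hm
  refine ⟨storeOf (StoreTree.rules hT.finite) (StoreTree.image hT.finite m)
    (StoreTree.image hT.finite c.mark), ?_, ?_, ?_, ?_, fun hd => ?_, fun n q x hx hne => ?_⟩
  · exact (holds_trapInv Δ _).2 ⟨hT.isMark_image hΔ hm',
      fun Z hZ hZ' => hT.trap_reach hΔ hκ hlam hm hZ' hZ⟩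
  · exact (holds_mutexInv Δ _).2 ⟨hT.isMark_image hΔ hm',
      fun Z hZ hZ' => hT.mutex_reach hΔ hκ hlam hc' hm hZ' hZ⟩
  · exact (holds_initForm Δ _ _).2 ⟨hT.isMark_image hΔ hc', fun w q => hT.mem_image_mark⟩
  · exact IsRewrTree.holds Δ (hT.isRewrTree hr hroot)
  · refine (holds_deadLock Δ _).2 fun Y Y' h hY => ?_
    obtain ⟨t, ht, hen⟩ := hT.exists_enabled hΔ h hY
    exact hd t ht hen
  · exact (holds_errSet Δ _ q).2 (hT.card_le_card_image hΔ hm' hx hne)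

end Soundness

end CBS

theorem mainTheorem3 {S : CBS.Signature} {β : CBS.Behavior S}
    (U : Type*) [Countable U] [Infinite U]
    (κ : ℕ) (hκ : 1 ≤ κ) (Δ : CBS.SID β) (hΔ : Δ.IsStandard)
    (hnpred : ∀ i, (Δ.rule i).body.npred ≤ κ)
    (φ : CBS.CL β) (hφ : φ.IsSentence) (r : Fin Δ.size) (hr : Δ.IsSentenceRule r φ)
    (htight : φ.IsTight Δ) {n : ℕ} (q : Fin n → β.State) :
    (¬ (CBS.deadlockVC κ Δ r).Satisfiable → ¬ CBS.Deadlock U φ Δ) ∧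
    (¬ (CBS.reachVC κ Δ r q).Satisfiable → ¬ CBS.Reach U φ q Δ) := by
  refine ⟨mt ?_, mt ?_⟩
  · rintro ⟨c, hc, m, hm, hd⟩
    obtain ⟨ν, h1, h2, h3, h4, h5, -⟩ := CBS.exists_store hΔ hnpred hr htight hc hm
    exact ⟨ν, h5 hd, h1, h2, h3, h4⟩
  · rintro ⟨c, m, x, hc, hm, hx, hne⟩
    obtain ⟨ν, h1, h2, h3, h4, -, h6⟩ := CBS.exists_store hΔ hnpred hr htight hc hm
    exact ⟨ν, h6 n q x hx hne, h1, h2, h3, h4⟩
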